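/- Let $G$ be a connected (finite-dimensional, real) Lie group with unit $\epsilon$ and Lie algebra $\mathcal G = T_\epsilon G$. A metric on a finite-dimensional real vector space is a nondegenerate symmetric bilinear form; a metric on $G$ is a smooth field of such forms on the tangent spaces (a Riemannian or pseudo-Riemannian metric). For $x\in\mathcal G$ let $x^+$ be the left invariant vector field with value $x$ at $\epsilon$. The canonical Cartan–Schouten connection of $G$ is the linear connection $\nabla$ on $G$ with $\nabla_{x^+}y^+=\frac12[x,y]^+$ for all $x,y\in\mathcal G$, and a Cartan–Schouten metric on $G$ is a metric $\mu$ on $G$ with $\nabla\mu=0$. For a metric $\bar\mu$ on $\mathcal G$ consider the condition $$\bar\mu([[x_1,x_2],y],z)+\bar\mu(y,[[x_1,x_2],z])=0\qquad\text{for all }x_1,x_2,y,z\in\mathcal G.\tag{$*$}$$ Then, for all $p,q\ge 0$, $G$ has a Cartan–Schouten metric of signature $(p,q)$ if and only if $\mathcal G$ has a metric of signature $(p,q)$ satisfying $(*)$. Furthermore, the two metrics coincide at the unit: if $\mu$ is a Cartan–Schouten metric on $G$, then $\bar\mu:=\mu_\epsilon$ is a metric on $\mathcal G$ that has the same signature as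 $\mu$ and satisfies $(*)$; conversely, for every metric $\bar\mu$ on $\mathcal G$ satisfying $(*)$ there is a Cartan–Schouten metric $\mu$ on $G$ with the same signature as $\bar\mu$ and with $\mu_\epsilon=\bar\mu$. Moreover, a bilinear form on $\mathcal G$ satisfies $(*)$ if and only if $\mathrm{ad}_u$ is skew-symmetric with respect to it for every $u\in[\mathcal G,\mathcal G]$. -/

import Mathlib

open scoped Manifold ContDiff
open Bundle

noncomputable section

/-! ### Metrics on a vector space and on a manifold -/

/-- A (possibly indefinite) metric on a real vector space: a symmetric nondegenerate bilinear
form. -/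
structure IsLinearMetric {V : Type*} [AddCommGroup V] [Module ℝ V]
    (B : LinearMap.BilinForm ℝ V) : Prop where
  symm : ∀ x y, B x y = B y x
  nondegenerate : ∀ x, (∀ y, B x y = 0) → x = 0

/-- The bilinear form `B` has signature `(p, q)`: `p` and `q` are the maximal dimensions of a
subspace on which `B` is positive definite, respectively negative definite. -/
def HasLinearSignature {V : Type*} [AddCommGroup V] [Module ℝ V]
    (B : LinearMap.BilinForm ℝ V) (p q : ℕ) : Prop :=
  sigPos B.toQuadraticMap = p ∧ sigNeg B.toQuadraticMap = q

section Manifold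

variable {E : Type*} [NormedAddCommGroup E] [NormedSpace ℝ E]
  {H : Type*} [TopologicalSpace H] (I : ModelWithCorners ℝ E H)
  (M : Type*) [TopologicalSpace M] [ChartedSpace H M] [IsManifold I ∞ M]

/-- A smooth Riemannian or pseudo-Riemannian metric on a manifold: a smooth field of symmetric
nondegenerate bilinear forms on the tangent spaces. -/
structure PseudoRiemannianMetric where
  /-- The bilinear form on each tangent space. -/
  val (x : M) : TangentSpace I x →L[ℝ] TangentSpace I x →L[ℝ] ℝ
  contMDiff : ContMDiff I (I.prod 𝓘(ℝ, E →L[ℝ] E →L[ℝ] ℝ)) ∞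
    (fun x ↦ TotalSpace.mk' (E →L[ℝ] E →L[ℝ] ℝ)
      (E := fun x : M ↦ TangentSpace I x →L[ℝ] TangentSpace I x →L[ℝ] ℝ) x (val x))
  isLinearMetric (x : M) : IsLinearMetric (val x).toBilinForm

namespace PseudoRiemannianMetric

variable {I M}

/-- The metric has signature `(p, q)` at every point. -/
def HasSignature (μ : PseudoRiemannianMetric I M) (p q : ℕ) : Prop :=
  ∀ x, HasLinearSignature (μ.val x).toBilinForm p q

/-- The metric is parallel for the linear connection `cov`, `∇ μ = 0`, that is
`X · μ(Y, Z) = μ(∇_X Y, Z) + μ(Y, ∇_X Z)` (`cov Y x v` is `∇_v Y` for `v` tangent at `x`). -/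
def IsParallel (μ : PseudoRiemannianMetric I M)
    (cov : CovariantDerivative I E (TangentSpace I : M → Type _)) : Prop :=
  ∀ (x : M) (Y Z : ∀ x : M, TangentSpace I x),
    MDifferentiableAt I (I.prod 𝓘(ℝ, E)) (fun x ↦ (⟨x, Y x⟩ : TangentBundle I M)) x →
    MDifferentiableAt I (I.prod 𝓘(ℝ, E)) (fun x ↦ (⟨x, Z x⟩ : TangentBundle I M)) x →
    ∀ v : TangentSpace I x,
      mvfderiv I (fun x ↦ μ.val x (Y x) (Z x)) x v =
        μ.val x (cov Y x v) (Z x) + μ.val x (Y x) (cov Z x v)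

end PseudoRiemannianMetric

end Manifold

/-! ### The canonical Cartan–Schouten connection of a Lie group -/

section LieGroup

variable {E : Type*} [NormedAddCommGroup E] [NormedSpace ℝ E]
  {H : Type*} [TopologicalSpace H] {I : ModelWithCorners ℝ E H}
  {G : Type*} [TopologicalSpace G] [ChartedSpace H G] [Group G]

instance lieGroupMinSmoothness [LieGroup I ∞ G] : LieGroup I (minSmoothness ℝ 3) G := by
  rw [minSmoothness_of_isRCLikeNormedField]
  infer_instance

instance tangentSpaceT2 (g : G) : T2Space (TangentSpace I g) :=
  inferInstanceAs (T2Space E)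

instance tangentSpaceFiniteDimensional [FiniteDimensional ℝ E] (g : G) :
    FiniteDimensional ℝ (TangentSpace I g) :=
  inferInstanceAs (FiniteDimensional ℝ E)

variable (I G) in
/-- The Lie algebra of `G`, the tangent space at the unit, is by definition a copy of the model
space `E`; this is the identification with the normed space `E`, used to differentiate functions
with values in the Lie algebra. -/
def lieAlgebraModelEquiv : GroupLieAlgebra I G ≃L[ℝ] E :=
  ContinuousLinearEquiv.refl ℝ E

/-- Left translation of a tangent vector at `g` to the unit (the left Maurer–Cartan form). -/
def maurerCartan (g : G) : TangentSpace I g →L[ℝ] GroupLieAlgebra I G :=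
  (mfderiv I I (fun h : G ↦ g * h) 1).inverse

/-- Left translation of a tangent vector at the unit to `g`. -/
def leftTranslate (g : G) : GroupLieAlgebra I G →L[ℝ] TangentSpace I g :=
  mfderiv I I (fun h : G ↦ g * h) 1

variable [LieGroup I ∞ G]

theorem isInvertible_leftTranslate (g : G) :
    (leftTranslate g : GroupLieAlgebra I G →L[ℝ] TangentSpace I g).IsInvertible := by
  have M : minSmoothness ℝ 3 ≠ 0 := lt_of_lt_of_le (by simp) le_minSmoothness |>.ne'
  have hd (a b : G) : MDifferentiableAt I I (fun x ↦ a * x) b :=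
    contMDiff_mul_left.contMDiffAt.mdifferentiableAt M
  have A := mfderiv_comp (I' := I) (1 : G) (hd g⁻¹ (g * 1)) (hd g 1)
  have A' := mfderiv_comp (I' := I) (g * 1 : G) (hd g (g⁻¹ * (g * 1))) (hd g⁻¹ (g * 1))
  rw [show ((fun x ↦ g⁻¹ * x) ∘ (fun x ↦ g * x) : G → G) = id by ext x; simp, mfderiv_id] at A
  rw [show ((fun x ↦ g * x) ∘ (fun x ↦ g⁻¹ * x) : G → G) = id by ext x; simp, mfderiv_id,
    inv_mul_cancel_left g 1] at A'
  exact .of_inverse A'.symm A.symm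

theorem maurerCartan_eq (g : G) (v : TangentSpace I g) :
    (⟨1, maurerCartan g v⟩ : TangentBundle I G) =
      tangentMap I I (fun h : G ↦ g⁻¹ * h) ⟨g, v⟩ := by
  have : maurerCartan g v = mfderiv I I (fun h : G ↦ g⁻¹ * h) (g * 1) v :=
    congrArg (fun f : E →L[ℝ] E ↦ f v) (inverse_mfderiv_mul_left (I := I) (g := g) (h := 1))
  have key (k : G) (hk : k = g) (a : G) (ha : a = g⁻¹ * g) :
      (⟨a, (mfderiv I I (fun h : G ↦ g⁻¹ * h) k v : E)⟩ : TangentBundle I G) =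
        tangentMap I I (fun h : G ↦ g⁻¹ * h) ⟨g, v⟩ := by
    subst hk ha
    rfl
  rw [this]
  exact key _ (mul_one g) _ (inv_mul_cancel g).symm

theorem maurerCartan_leftTranslate (g : G) (v : GroupLieAlgebra I G) :
    maurerCartan g (leftTranslate g v) = v :=
  (isInvertible_leftTranslate g).inverse_apply_self v

theorem leftTranslate_maurerCartan (g : G) (v : TangentSpace I g) :
    leftTranslate g (maurerCartan g v) = v :=
  (isInvertible_leftTranslate g).self_apply_inverse v

theorem mdifferentiableAt_maurerCartan {Y : ∀ g : G, TangentSpace I g} {g : G}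
    (hY : MDifferentiableAt I (I.prod 𝓘(ℝ, E)) (fun x ↦ (⟨x, Y x⟩ : TangentBundle I G)) g) :
    MDifferentiableAt I 𝓘(ℝ, E) (fun h ↦ lieAlgebraModelEquiv I G (maurerCartan h (Y h))) g := by
  let F₁ : G → TangentBundle I G × TangentBundle I G :=
    fun h ↦ (⟨h⁻¹, 0⟩, ⟨h, Y h⟩)
  have S₁ : MDifferentiableAt I (I.tangent.prod I.tangent) F₁ g := by
    refine MDifferentiableAt.prodMk ?_ hY
    have h0 : ContMDiff I I.tangent 1 (fun h : G ↦ (⟨h, 0⟩ : TangentBundle I G)) :=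
      contMDiff_zeroSection _ _
    exact ((h0.comp (contMDiff_inv I 1)).mdifferentiable one_ne_zero) g
  let F₂ : TangentBundle I G × TangentBundle I G → TangentBundle (I.prod I) (G × G) :=
    (equivTangentBundleProd I G I G).symm
  have S₂ : ContMDiff (I.tangent.prod I.tangent) (I.prod I).tangent 1 F₂ :=
    contMDiff_equivTangentBundleProd_symm
  let F₃ : TangentBundle (I.prod I) (G × G) → TangentBundle I G :=
    tangentMap (I.prod I) I (fun p : G × G ↦ p.1 * p.2)
  have S₃ : ContMDiff (I.prod I).tangent I.tangent 1 F₃ :=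
    ContMDiff.contMDiff_tangentMap (contMDiff_mul I 2) (by norm_num)
  have S : MDifferentiableAt I I.tangent (F₃ ∘ F₂ ∘ F₁) g :=
    (((S₃.comp S₂).mdifferentiable one_ne_zero) (F₁ g)).comp g S₁
  have hS : F₃ ∘ F₂ ∘ F₁ = fun h ↦ (⟨1, maurerCartan h (Y h)⟩ : TangentBundle I G) := by
    funext h
    rw [maurerCartan_eq]
    have M : MDifferentiableAt (I.prod I) I (fun p : G × G ↦ p.1 * p.2) (h⁻¹, h) :=
      (contMDiff_mul I 1).mdifferentiable one_ne_zero _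
    let w : E × E := (0, Y h)
    have e := mfderiv_prod_eq_add_apply (v := w) M
    have e' : mfderiv (I.prod I) I (fun p : G × G ↦ p.1 * p.2) (h⁻¹, h) w =
        mfderiv I I (fun x : G ↦ h⁻¹ * x) h (Y h) := by
      refine e.trans ?_
      exact (congrArg₂ (· + ·) (map_zero (mfderiv I I (fun x : G ↦ x * h) h⁻¹)) rfl).trans
        (zero_add _)
    exact congrArg (fun w : E ↦ (⟨h⁻¹ * h, w⟩ : TangentBundle I G)) e'
  rw [hS, mdifferentiableAt_totalSpace] at S
  have S' := S.2
  refine S'.congr_of_eventuallyEq (.of_forall fun h ↦ ?_)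
  exact ((tangentBundleCore I G).coordChange_self (achart H (1 : G)) 1
    (mem_achart_source H (1 : G)) (maurerCartan h (Y h))).symm

variable (I G) in
/-- The flat linear connection for which the left invariant vector fields are parallel. -/
def leftInvariantFlatConnection : CovariantDerivative I E (TangentSpace I : G → Type _) where
  toFun Y g := leftTranslate g ∘L (lieAlgebraModelEquiv I G).symm.toContinuousLinearMap ∘L
    mvfderiv I (fun h ↦ lieAlgebraModelEquiv I G (maurerCartan h (Y h))) g
  isCovariantDerivativeOnUniv :=
    { add := by
        intro Y Z g hY hZ _
        have := mvfderiv_fun_add (mdifferentiableAt_maurerCartan hY)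
          (mdifferentiableAt_maurerCartan hZ)
        ext v
        simp [this]
      leibniz := by
        intro Y f g hY hf _
        have := mvfderiv_fun_smul hf (mdifferentiableAt_maurerCartan hY)
        ext v
        simp [this, leftTranslate_maurerCartan] }

variable [FiniteDimensional ℝ E]

theorem isBilinearMap_cartanSchouten (g : G) :
    IsBilinearMap ℝ fun y x : TangentSpace I g ↦
      (1 / 2 : ℝ) • leftTranslate g ⁅maurerCartan g x, maurerCartan g y⁆ where
  add_left := by simp
  smul_left c x y := by simp [smul_comm c]
  add_right := by simp
  smul_right c x y := by simp [smul_comm c]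

variable (I G) in
/-- The canonical Cartan–Schouten connection of a Lie group: the linear connection with
`∇_{x⁺} y⁺ = (1/2) [x, y]⁺` for all left invariant vector fields `x⁺`, `y⁺`. -/
def cartanSchoutenConnection : CovariantDerivative I E (TangentSpace I : G → Type _) :=
  (leftInvariantFlatConnection I G).addOneForm fun g ↦
    (isBilinearMap_cartanSchouten g).toContinuousBilinearMap

theorem cartanSchoutenConnection_mulInvariantVectorField (x y : GroupLieAlgebra I G) (g : G) :
    cartanSchoutenConnection I G (mulInvariantVectorField y) g (mulInvariantVectorField x g) =
      (1 / 2 : ℝ) • mulInvariantVectorField ⁅x, y⁆ g := by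
  have h : (fun h : G ↦ lieAlgebraModelEquiv I G (maurerCartan h (mulInvariantVectorField y h))) =
      fun _ ↦ lieAlgebraModelEquiv I G y := by
    funext h
    rw [show mulInvariantVectorField y h = leftTranslate h y from rfl, maurerCartan_leftTranslate]
  have hd : mvfderiv I (fun h : G ↦
      lieAlgebraModelEquiv I G (maurerCartan h (mulInvariantVectorField y h))) g = 0 := by
    rw [h]
    ext v
    simp [mvfderiv]
  have hθ (v : GroupLieAlgebra I G) : maurerCartan g (mulInvariantVectorField v g) = v :=
    maurerCartan_leftTranslate g v
  change leftTranslate g ((lieAlgebraModelEquiv I G).symm (mvfderiv I (fun h : G ↦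
      lieAlgebraModelEquiv I G (maurerCartan h (mulInvariantVectorField y h))) g
        (mulInvariantVectorField x g))) +
    (1 / 2 : ℝ) • leftTranslate g ⁅maurerCartan g (mulInvariantVectorField x g),
      maurerCartan g (mulInvariantVectorField y g)⁆ = _
  rw [hd, hθ, hθ]
  simp only [zero_apply, map_zero, zero_add]
  rfl

/-! ### Cartan–Schouten metrics -/

/-- A Cartan–Schouten metric on a Lie group: a metric which is parallel for the canonical
Cartan–Schouten connection. -/
def PseudoRiemannianMetric.IsCartanSchouten (μ : PseudoRiemannianMetric I G) : Prop :=
  μ.IsParallel (cartanSchoutenConnection I G)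

/-- The value of a metric at the unit, as a bilinear form on the Lie algebra. -/
def PseudoRiemannianMetric.atUnit (μ : PseudoRiemannianMetric I G) :
    LinearMap.BilinForm ℝ (GroupLieAlgebra I G) :=
  (μ.val 1).toBilinForm

end LieGroup

section LieAlgebra

variable {L : Type*} [LieRing L] [LieAlgebra ℝ L]

/-- `B([[x₁, x₂], y], z) + B(y, [[x₁, x₂], z]) = 0` for all `x₁, x₂, y, z`. -/
def SatisfiesCartanSchoutenEquation (B : LinearMap.BilinForm ℝ L) : Prop :=
  ∀ x₁ x₂ y z : L, B ⁅⁅x₁, x₂⁆, y⁆ z + B y ⁅⁅x₁, x₂⁆, z⁆ = 0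

end LieAlgebra

end

noncomputable section

set_option linter.unusedSectionVars false

section LieAlgebraForms

variable {L : Type*} [LieRing L] [LieAlgebra ℝ L]

/-- The pull-back of bilinear forms along a linear map. -/
def bilinPullback (T : L →ₗ[ℝ] L) : LinearMap.BilinForm ℝ L →ₗ[ℝ] LinearMap.BilinForm ℝ L where
  toFun B := B.compl₁₂ T T
  map_add' _ _ := rfl
  map_smul' _ _ := rfl

/-- The derivation action of `x` on bilinear forms,
`(x · B)(y, z) = B([x, y], z) + B(y, [x, z])`. -/
def bilinLie (x : L) : LinearMap.BilinForm ℝ L →ₗ[ℝ] LinearMap.BilinForm ℝ L where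
  toFun B := B.compl₁₂ (LieAlgebra.ad ℝ L x) LinearMap.id +
    B.compl₁₂ LinearMap.id (LieAlgebra.ad ℝ L x)
  map_add' B C := by ext; simp; ring
  map_smul' c B := by ext; simp

theorem bilinLie_apply (x : L) (B : LinearMap.BilinForm ℝ L) (y z : L) :
    bilinLie x B y z = B ⁅x, y⁆ z + B y ⁅x, z⁆ := by
  simp [bilinLie]

variable (L) in
/-- The symmetric bilinear forms that are invariant under the derived algebra. -/
def cartanSchoutenForms : Submodule ℝ (LinearMap.BilinForm ℝ L) where
  carrier := {B | (∀ x y, B x y = B y x) ∧ SatisfiesCartanSchoutenEquation B}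
  add_mem' := by
    rintro B C ⟨hB, hB'⟩ ⟨hC, hC'⟩
    refine ⟨fun x y ↦ by simp [hB x y, hC x y], fun x₁ x₂ y z ↦ ?_⟩
    have h₁ := hB' x₁ x₂ y z
    have h₂ := hC' x₁ x₂ y z
    simp only [LinearMap.add_apply]
    linarith
  zero_mem' := ⟨by simp, fun _ _ _ _ ↦ by simp⟩
  smul_mem' := by
    rintro c B ⟨hB, hB'⟩
    refine ⟨fun x y ↦ by simp [hB x y], fun x₁ x₂ y z ↦ ?_⟩
    have h₁ := hB' x₁ x₂ y z
    simp only [LinearMap.smul_apply, smul_eq_mul]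
    linear_combination c * h₁

variable {B : LinearMap.BilinForm ℝ L}

theorem bilinLie_mem_cartanSchoutenForms (hB : B ∈ cartanSchoutenForms L) (x : L) :
    bilinLie x B ∈ cartanSchoutenForms L := by
  obtain ⟨hs, hB⟩ := hB
  refine ⟨fun y z ↦ ?_, fun a b y z ↦ ?_⟩
  · rw [bilinLie_apply, bilinLie_apply, hs ⁅x, y⁆ z, hs y ⁅x, z⁆, add_comm]
  · simp only [bilinLie_apply]
    have h₁ := hB x ⁅a, b⁆ y z
    have h₂ := hB a b ⁅x, y⁆ z
    have h₃ := hB a b y ⁅x, z⁆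
    rw [leibniz_lie x ⁅a, b⁆ y, leibniz_lie x ⁅a, b⁆ z]
    simp only [map_add, LinearMap.add_apply]
    linarith

theorem bilinLie_comm (hB : B ∈ cartanSchoutenForms L) (x y : L) :
    bilinLie x (bilinLie y B) = bilinLie y (bilinLie x B) := by
  ext v w
  have h := hB.2 x y v w
  simp only [bilinLie_apply]
  rw [leibniz_lie x y v, leibniz_lie x y w]
  simp only [lie_lie, map_sub, LinearMap.sub_apply, map_add, LinearMap.add_apply] at h ⊢
  linarith

theorem bilinLie_apply_lie_lie (hB : B ∈ cartanSchoutenForms L) (x a b c d : L) :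
    bilinLie x B ⁅a, b⁆ ⁅c, d⁆ = 0 := by
  have h₁ := hB.2 a b x ⁅c, d⁆
  have h₂ := hB.2 c d ⁅a, b⁆ x
  have h₃ := hB.1 x ⁅⁅a, b⁆, ⁅c, d⁆⁆
  rw [bilinLie_apply]
  rw [← lie_skew ⁅a, b⁆ x, map_neg, LinearMap.neg_apply] at h₁
  rw [← lie_skew ⁅c, d⁆ x, map_neg, ← lie_skew ⁅c, d⁆ ⁅a, b⁆, map_neg, LinearMap.neg_apply] at h₂
  linarith

theorem bilinLie_bilinLie_apply_lie (hB : B ∈ cartanSchoutenForms L) (x y a b v : L) :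
    bilinLie x (bilinLie y B) ⁅a, b⁆ v = 0 := by
  have key (x y : L) : bilinLie x (bilinLie y B) ⁅a, b⁆ v =
      B ⁅y, x⁆ ⁅⁅a, b⁆, v⁆ + B ⁅⁅⁅a, b⁆, v⁆, x⁆ y := by
    have hC := bilinLie_mem_cartanSchoutenForms hB y
    have h₁ := hC.2 a b x v
    have h₂ := bilinLie_apply_lie_lie hB y a b x v
    have h₃ := hB.2 ⁅a, b⁆ v x y
    rw [bilinLie_apply, h₂, add_zero]
    rw [← lie_skew ⁅a, b⁆ x, map_neg, LinearMap.neg_apply, bilinLie_apply y B x] at h₁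
    rw [← lie_skew ⁅⁅a, b⁆, v⁆ y, map_neg] at h₃
    linarith
  have h₁ := key x y
  have h₂ := key y x
  have h₃ := hB.2 ⁅a, b⁆ v x y
  rw [bilinLie_comm hB y x] at h₂
  rw [← lie_skew x y, map_neg, LinearMap.neg_apply, ← hB.1 x] at h₂
  linarith

theorem bilinLie_bilinLie_bilinLie (hB : B ∈ cartanSchoutenForms L) (x y z : L) :
    bilinLie x (bilinLie y (bilinLie z B)) = 0 := by
  have hE := bilinLie_mem_cartanSchoutenForms (bilinLie_mem_cartanSchoutenForms hB z) y
  ext v w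
  rw [bilinLie_apply, bilinLie_bilinLie_apply_lie hB, hE.1 v, bilinLie_bilinLie_apply_lie hB]
  simp

theorem satisfiesCartanSchoutenEquation_iff_isSkewAdjoint (B : LinearMap.BilinForm ℝ L) :
    SatisfiesCartanSchoutenEquation B ↔
      ∀ u ∈ LieAlgebra.derivedSeries ℝ L 1, B.IsSkewAdjoint (LieAlgebra.ad ℝ L u) := by
  constructor
  · intro h u hu
    have hu' : u ∈ Submodule.span ℝ {m : L | ∃ x₁ x₂ : L, ⁅x₁, x₂⁆ = m} := by
      have : LieAlgebra.derivedSeries ℝ L 1 = ⁅(⊤ : LieIdeal ℝ L), (⊤ : LieIdeal ℝ L)⁆ := rfl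
      rw [this, ← LieSubmodule.mem_toSubmodule,
        LieSubmodule.lieIdeal_oper_eq_linear_span'] at hu
      simpa using hu
    clear hu
    induction hu' using Submodule.span_induction with
    | mem m hm =>
      obtain ⟨x₁, x₂, rfl⟩ := hm
      intro y z
      have := h x₁ x₂ y z
      simp only [LieAlgebra.ad_apply, Pi.neg_apply, map_neg]
      linarith
    | zero => intro y z; simp
    | add u v _ _ hu hv =>
      intro y z
      have h₁ := hu y z
      have h₂ := hv y z
      simp only [LieAlgebra.ad_apply, Pi.neg_apply, map_neg, map_add,
        LinearMap.add_apply] at h₁ h₂ ⊢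
      linarith
    | smul c u _ hu =>
      intro y z
      have h₁ := hu y z
      simp only [LieAlgebra.ad_apply, Pi.neg_apply, map_neg, map_smul,
        LinearMap.smul_apply, smul_eq_mul] at h₁ ⊢
      rw [h₁, mul_neg]
  · intro h x₁ x₂ y z
    have hu : ⁅x₁, x₂⁆ ∈ LieAlgebra.derivedSeries ℝ L 1 :=
      LieSubmodule.lie_mem_lie (LieSubmodule.mem_top x₁) (LieSubmodule.mem_top x₂)
    have := h _ hu y z
    simp only [LieAlgebra.ad_apply, Pi.neg_apply, map_neg] at this
    linarith

end LieAlgebraForms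

section ManifoldCalculus

open Set Filter VectorField
open scoped Topology

variable {E : Type*} [NormedAddCommGroup E] [NormedSpace ℝ E]
  {H : Type*} [TopologicalSpace H] {I : ModelWithCorners ℝ E H}
  {M : Type*} [TopologicalSpace M] [ChartedSpace H M]
  {E' : Type*} [NormedAddCommGroup E'] [NormedSpace ℝ E']
  {H' : Type*} [TopologicalSpace H'] {I' : ModelWithCorners ℝ E' H'}
  {M' : Type*} [TopologicalSpace M'] [ChartedSpace H' M']
  {F : Type*} [NormedAddCommGroup F] [NormedSpace ℝ F]
  {F' : Type*} [NormedAddCommGroup F'] [NormedSpace ℝ F']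
  {F'' : Type*} [NormedAddCommGroup F''] [NormedSpace ℝ F'']

theorem mvfderiv_eq_fderiv_comp_extChartAt_symm [I.Boundaryless] {f : M → F} {x : M}
    (hf : MDifferentiableAt I 𝓘(ℝ, F) f x) (v : TangentSpace I x) :
    mvfderiv I f x v =
      fderiv ℝ (f ∘ (extChartAt I x).symm) (extChartAt I x x) (v : E) := by
  rw [hf.mvfderiv, I.range_eq_univ, fderivWithin_univ]
  rfl

theorem mvfderiv_comp_apply' {f : M' → F} {ψ : M → M'} {x : M} {y : M'}
    (hf : MDifferentiableAt I' 𝓘(ℝ, F) f y) (hψ : MDifferentiableAt I I' ψ x) (hy : ψ x = y)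
    (v : TangentSpace I x) :
    mvfderiv I (fun z ↦ f (ψ z)) x v = mvfderiv I' f (ψ x) (mfderiv I I' ψ x v) := by
  subst hy
  exact mfderiv_comp_apply x hf hψ v

theorem mvfderiv_congr_of_eventuallyEq {f g : M → F} {x : M} (h : f =ᶠ[𝓝 x] g)
    (v : TangentSpace I x) : mvfderiv I f x v = mvfderiv I g x v :=
  congrArg (fun T : E →L[ℝ] F ↦ T v) h.mfderiv_eq

theorem mvfderiv_clm_apply_comp (T : F →L[ℝ] F') {f : M → F} {x : M}
    (hf : MDifferentiableAt I 𝓘(ℝ, F) f x) (v : TangentSpace I x) :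
    mvfderiv I (fun z ↦ T (f z)) x v = T (mvfderiv I f x v) := by
  have := mfderiv_comp_apply (I := I) (I' := 𝓘(ℝ, F)) (I'' := 𝓘(ℝ, F')) x
    (T.contMDiff (n := 1) |>.mdifferentiableAt one_ne_zero) hf v
  rw [T.mfderiv_eq] at this
  exact this

theorem mvfderiv_bilin (b : F →L[ℝ] F' →L[ℝ] F'') {f : M → F} {g : M → F'} {x : M}
    (hf : MDifferentiableAt I 𝓘(ℝ, F) f x) (hg : MDifferentiableAt I 𝓘(ℝ, F') g x)
    (v : TangentSpace I x) :
    mvfderiv I (fun z ↦ b (f z) (g z)) x v =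
      b (mvfderiv I f x v) (g x) + b (f x) (mvfderiv I g x v) := by
  have := HasMFDerivAt.mfderiv (I := I) (I' := 𝓘(ℝ, F'')) (f := fun z ↦ b (f z) (g z)) (x := x)
    ⟨((b.continuous.continuousAt.comp hf.continuousAt).clm_apply hg.continuousAt :),
      b.hasFDerivWithinAt_of_bilinear hf.hasMFDerivAt.2 hg.hasMFDerivAt.2⟩
  refine (congrArg (fun T : E →L[ℝ] F'' ↦ T v) this).trans ?_
  refine (add_comm _ _).trans ?_
  simp only [extChartAt_to_inv]
  rfl

theorem mdifferentiableAt_bilin (b : F →L[ℝ] F' →L[ℝ] F'') {f : M → F} {g : M → F'} {x : M}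
    (hf : MDifferentiableAt I 𝓘(ℝ, F) f x) (hg : MDifferentiableAt I 𝓘(ℝ, F') g x) :
    MDifferentiableAt I 𝓘(ℝ, F'') (fun z ↦ b (f z) (g z)) x :=
  HasMFDerivAt.mdifferentiableAt
    ⟨((b.continuous.continuousAt.comp hf.continuousAt).clm_apply hg.continuousAt :),
      b.hasFDerivWithinAt_of_bilinear hf.hasMFDerivAt.2 hg.hasMFDerivAt.2⟩

theorem isLocallyConstant_of_mvfderiv_eq_zero [I.Boundaryless] [IsManifold I 1 M] {f : M → F}
    (hf : MDifferentiable I 𝓘(ℝ, F) f) (h : ∀ x v, mvfderiv I f x v = 0) :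
    IsLocallyConstant f := by
  rw [IsLocallyConstant.iff_eventually_eq]
  intro x
  set φ := extChartAt I x
  obtain ⟨r, hr, hball⟩ := Metric.mem_nhds_iff.1 (extChartAt_target_mem_nhds (I := I) x)
  have hsymm {z : E} (hz : z ∈ Metric.ball (φ x) r) :
      MDifferentiableAt 𝓘(ℝ, E) I φ.symm z := by
    have := mdifferentiableWithinAt_extChartAt_symm (I := I) (hball hz)
    rwa [I.range_eq_univ, mdifferentiableWithinAt_univ] at this
  have hd {z : E} (hz : z ∈ Metric.ball (φ x) r) :
      MDifferentiableAt 𝓘(ℝ, E) 𝓘(ℝ, F) (f ∘ φ.symm) z :=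
    (hf (φ.symm z)).comp z (hsymm hz)
  have hz0 {z : E} (hz : z ∈ Metric.ball (φ x) r) : fderiv ℝ (f ∘ φ.symm) z = 0 := by
    ext v
    have := mvfderiv_comp_apply' (I := 𝓘(ℝ, E)) (I' := I) (hf (φ.symm z)) (hsymm hz) rfl v
    rw [h] at this
    rw [← mfderiv_eq_fderiv]
    exact this
  have hc (z : E) (hz : z ∈ Metric.ball (φ x) r) : (f ∘ φ.symm) z = (f ∘ φ.symm) (φ x) := by
    refine Metric.isOpen_ball.is_const_of_fderiv_eq_zero
      (convex_ball (φ x) r).isPreconnected (fun w hw ↦ ?_) (fun w hw ↦ hz0 hw) hz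
      (Metric.mem_ball_self hr)
    exact (hd hw).differentiableAt.differentiableWithinAt
  filter_upwards [(continuousAt_extChartAt x).preimage_mem_nhds (Metric.ball_mem_nhds (φ x) hr),
    extChartAt_source_mem_nhds (I := I) x] with y hy hy'
  have := hc (φ y) hy
  rwa [Function.comp_apply, Function.comp_apply, φ.left_inv hy',
    φ.left_inv (mem_extChartAt_source x)] at this

theorem eq_of_mvfderiv_eq_zero [I.Boundaryless] [IsManifold I 1 M] [PreconnectedSpace M]
    {f : M → F} (hf : MDifferentiable I 𝓘(ℝ, F) f) (h : ∀ x v, mvfderiv I f x v = 0) (x y : M) :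
    f x = f y :=
  (isLocallyConstant_of_mvfderiv_eq_zero hf h).apply_eq_of_preconnectedSpace x y

theorem fderiv_fderiv_swap {Φ : E × E' → F} {a : E} {b : E'} (hΦ : ContDiffAt ℝ 2 Φ (a, b))
    (x : E) (y : E') :
    fderiv ℝ (fun v ↦ fderiv ℝ (fun u ↦ Φ (u, v)) a x) b y =
      fderiv ℝ (fun u ↦ fderiv ℝ (fun v ↦ Φ (u, v)) b y) a x := by
  have hev : ∀ᶠ p in 𝓝 (a, b), DifferentiableAt ℝ Φ p :=
    (hΦ.eventually (by simp)).mono fun p hp ↦ hp.differentiableAt (by simp)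
  have hd : DifferentiableAt ℝ (fderiv ℝ Φ) (a, b) :=
    (hΦ.fderiv_right (m := 1) (by norm_num)).differentiableAt one_ne_zero
  have h₁ : (fun v ↦ fderiv ℝ (fun u ↦ Φ (u, v)) a x) =ᶠ[𝓝 b]
      fun v ↦ fderiv ℝ Φ (a, v) (x, 0) := by
    have : ∀ᶠ v in 𝓝 b, DifferentiableAt ℝ Φ (a, v) :=
      (Continuous.prodMk_right a).continuousAt.eventually hev
    filter_upwards [this] with v hv
    have := (HasFDerivAt.comp (g := Φ) (f := fun e ↦ (e, v)) a hv.hasFDerivAt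
      (hasFDerivAt_prodMk_left a v)).fderiv
    exact congrArg (fun T : E →L[ℝ] F ↦ T x) this
  have h₂ : (fun u ↦ fderiv ℝ (fun v ↦ Φ (u, v)) b y) =ᶠ[𝓝 a]
      fun u ↦ fderiv ℝ Φ (u, b) (0, y) := by
    have : ∀ᶠ u in 𝓝 a, DifferentiableAt ℝ Φ (u, b) :=
      (Continuous.prodMk_left b).continuousAt.eventually hev
    filter_upwards [this] with u hu
    have := (HasFDerivAt.comp (g := Φ) b hu.hasFDerivAt (hasFDerivAt_prodMk_right u b)).fderiv
    exact congrArg (fun T : E' →L[ℝ] F ↦ T y) this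
  rw [h₁.fderiv_eq, h₂.fderiv_eq]
  have d₁ : HasFDerivAt (fun v ↦ fderiv ℝ Φ (a, v)) _ b :=
    HasFDerivAt.comp (g := fderiv ℝ Φ) b hd.hasFDerivAt (hasFDerivAt_prodMk_right a b)
  have d₂ : HasFDerivAt (fun u ↦ fderiv ℝ Φ (u, b)) _ a :=
    HasFDerivAt.comp (g := fderiv ℝ Φ) a hd.hasFDerivAt (hasFDerivAt_prodMk_left a b)
  rw [(d₁.clm_apply (hasFDerivAt_const (x, (0 : E')) b)).fderiv,
    (d₂.clm_apply (hasFDerivAt_const ((0 : E), y) a)).fderiv]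
  simpa using hΦ.isSymmSndFDerivAt (by simp) (0, y) (x, 0)

theorem contMDiffAt_extChartAt_symm [I.Boundaryless] {n : WithTop ℕ∞} [IsManifold I n M] (x : M)
    {z : E} (hz : z ∈ (extChartAt I x).target) :
    ContMDiffAt 𝓘(ℝ, E) I n (extChartAt I x).symm z :=
  ((contMDiffOn_extChartAt_symm x) z hz).contMDiffAt
    ((isOpen_extChartAt_target x).mem_nhds hz)

theorem mvfderiv_mvfderiv_swap [I.Boundaryless] [IsManifold I 2 M] [I'.Boundaryless]
    [IsManifold I' 2 M'] {Φ : M × M' → F} {a : M} {b : M'}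
    (hΦ : ContMDiffAt (I.prod I') 𝓘(ℝ, F) 2 Φ (a, b))
    (x : TangentSpace I a) (y : TangentSpace I' b)
    (h₁ : MDifferentiableAt I' 𝓘(ℝ, F) (fun v ↦ mvfderiv I (fun u ↦ Φ (u, v)) a x) b)
    (h₂ : MDifferentiableAt I 𝓘(ℝ, F) (fun u ↦ mvfderiv I' (fun v ↦ Φ (u, v)) b y) a) :
    mvfderiv I' (fun v ↦ mvfderiv I (fun u ↦ Φ (u, v)) a x) b y =
      mvfderiv I (fun u ↦ mvfderiv I' (fun v ↦ Φ (u, v)) b y) a x := by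
  rw [mvfderiv_eq_fderiv_comp_extChartAt_symm h₁, mvfderiv_eq_fderiv_comp_extChartAt_symm h₂]
  set φ := extChartAt I a
  set φ' := extChartAt I' b
  have hφ : φ.symm (φ a) = a := extChartAt_to_inv a
  have hφ' : φ'.symm (φ' b) = b := extChartAt_to_inv b
  have cφ : ContMDiffAt 𝓘(ℝ, E) I 2 φ.symm (φ a) :=
    contMDiffAt_extChartAt_symm a (mem_extChartAt_target a)
  have cφ' : ContMDiffAt 𝓘(ℝ, E') I' 2 φ'.symm (φ' b) :=
    contMDiffAt_extChartAt_symm b (mem_extChartAt_target b)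
  have hev : ∀ᶠ p in 𝓝 (a, b), MDifferentiableAt (I.prod I') 𝓘(ℝ, F) Φ p :=
    (((contMDiffAt_iff_contMDiffAt_nhds (by decide)).1 hΦ).mono
      fun p hp ↦ hp.mdifferentiableAt (by simp))
  have e₁ : ((fun v ↦ mvfderiv I (fun u ↦ Φ (u, v)) a x) ∘ φ'.symm) =ᶠ[𝓝 (φ' b)]
      fun v ↦ fderiv ℝ (fun u ↦ Φ (φ.symm u, φ'.symm v)) (φ a) (x : E) := by
    have hc : ContinuousAt (fun v ↦ (a, φ'.symm v)) (φ' b) :=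
      continuousAt_const.prodMk cφ'.continuousAt
    have := hc.eventually (p := MDifferentiableAt (I.prod I') 𝓘(ℝ, F) Φ)
      (by beta_reduce; rwa [hφ'])
    filter_upwards [this] with v hv
    refine mvfderiv_eq_fderiv_comp_extChartAt_symm (f := fun u ↦ Φ (u, φ'.symm v)) ?_ x
    exact hv.comp a (mdifferentiableAt_id.prodMk mdifferentiableAt_const)
  have e₂ : ((fun u ↦ mvfderiv I' (fun v ↦ Φ (u, v)) b y) ∘ φ.symm) =ᶠ[𝓝 (φ a)]
      fun u ↦ fderiv ℝ (fun v ↦ Φ (φ.symm u, φ'.symm v)) (φ' b) (y : E') := by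
    have hc : ContinuousAt (fun u ↦ (φ.symm u, b)) (φ a) :=
      cφ.continuousAt.prodMk continuousAt_const
    have := hc.eventually (p := MDifferentiableAt (I.prod I') 𝓘(ℝ, F) Φ)
      (by beta_reduce; rwa [hφ])
    filter_upwards [this] with u hu
    refine mvfderiv_eq_fderiv_comp_extChartAt_symm (f := fun v ↦ Φ (φ.symm u, v)) ?_ y
    exact hu.comp b (mdifferentiableAt_const.prodMk mdifferentiableAt_id)
  rw [e₁.fderiv_eq, e₂.fderiv_eq]
  have hc : ContDiffAt ℝ 2 (fun p : E × E' ↦ Φ (φ.symm p.1, φ'.symm p.2)) (φ a, φ' b) := by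
    have h₁ : ContMDiffAt 𝓘(ℝ, E × E') I 2 (fun p : E × E' ↦ φ.symm p.1) (φ a, φ' b) :=
      cφ.comp (φ a, φ' b) contDiff_fst.contMDiff.contMDiffAt
    have h₂ : ContMDiffAt 𝓘(ℝ, E × E') I' 2 (fun p : E × E' ↦ φ'.symm p.2) (φ a, φ' b) :=
      cφ'.comp (φ a, φ' b) contDiff_snd.contMDiff.contMDiffAt
    refine ContMDiffAt.contDiffAt ?_
    refine ContMDiffAt.comp (φ a, φ' b) (g := Φ) ?_ (h₁.prodMk h₂)
    rwa [hφ, hφ']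
  exact fderiv_fderiv_swap hc (x : E) (y : E')

theorem mvfderiv_mlieBracket [I.Boundaryless] [IsManifold I 2 M] [CompleteSpace E]
    {f : M → F} {V W : ∀ x : M, TangentSpace I x} {x : M}
    (hf : ContMDiffAt I 𝓘(ℝ, F) 2 f x)
    (hV : MDifferentiableAt I (I.prod 𝓘(ℝ, E)) (fun x ↦ (⟨x, V x⟩ : TangentBundle I M)) x)
    (hW : MDifferentiableAt I (I.prod 𝓘(ℝ, E)) (fun x ↦ (⟨x, W x⟩ : TangentBundle I M)) x)
    (hfV : MDifferentiableAt I 𝓘(ℝ, F) (fun y ↦ mvfderiv I f y (V y)) x)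
    (hfW : MDifferentiableAt I 𝓘(ℝ, F) (fun y ↦ mvfderiv I f y (W y)) x) :
    mvfderiv I f x (mlieBracket I V W x) =
      mvfderiv I (fun y ↦ mvfderiv I f y (W y)) x (V x) -
        mvfderiv I (fun y ↦ mvfderiv I f y (V y)) x (W x) := by
  set φ := extChartAt I x with hφ
  let pull (V : ∀ x : M, TangentSpace I x) (z : E) : E :=
    mpullbackWithin 𝓘(ℝ, E) I φ.symm V (range I) z
  have hpull (V : ∀ x : M, TangentSpace I x) : pull V (φ x) = V x := by
    refine Eq.trans ?_ (mfderivWithin_extChartAt_symm_inverse_apply (V x))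
    exact congrArg (fun w : E ↦ (mfderivWithin 𝓘(ℝ, E) I φ.symm (range I) (φ x)).inverse w)
      (congrArg (fun y ↦ (V y : E)) (extChartAt_to_inv x))
  have hdiff (V : ∀ x : M, TangentSpace I x)
      (hV : MDifferentiableAt I (I.prod 𝓘(ℝ, E)) (fun x ↦ (⟨x, V x⟩ : TangentBundle I M)) x) :
      DifferentiableAt ℝ (pull V) (φ x) := by
    have := (mdifferentiableWithinAt_univ.2 hV).differentiableWithinAt_mpullbackWithin_vectorField
    have hu : φ.symm ⁻¹' univ ∩ range I = univ := by
      rw [I.range_eq_univ, preimage_univ, univ_inter]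
    have key : DifferentiableWithinAt ℝ (pull V) (φ.symm ⁻¹' univ ∩ range I) (φ x) := this
    rwa [hu, differentiableWithinAt_univ] at key
  have hbr : (mlieBracket I V W x : E) = lieBracket ℝ (pull V) (pull W) (φ x) := by
    have hu : φ.symm ⁻¹' univ ∩ range I = univ := by
      rw [I.range_eq_univ, preimage_univ, univ_inter]
    have h₁ : (mlieBracket I V W x : E) =
        (mfderiv I 𝓘(ℝ, E) φ x).inverse
          (lieBracketWithin ℝ (E := E) (pull V) (pull W) (φ.symm ⁻¹' univ ∩ range I) (φ x) : E) :=
      rfl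
    rw [h₁, hu, lieBracketWithin_univ, hφ, mfderiv_extChartAt_self]
    exact congrArg (fun T : E →L[ℝ] E ↦ T _) ContinuousLinearMap.inverse_id
  have hev (V : ∀ x : M, TangentSpace I x) :
      ((fun y ↦ mvfderiv I f y (V y)) ∘ φ.symm) =ᶠ[𝓝 (φ x)]
        fun z ↦ fderiv ℝ (f ∘ φ.symm) z (pull V z) := by
    have h₂ : ∀ᶠ y in 𝓝 (φ.symm (φ x)), MDifferentiableAt I 𝓘(ℝ, F) f y := by
      rw [extChartAt_to_inv x]
      exact ((contMDiffAt_iff_contMDiffAt_nhds (by decide)).1 hf).mono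
        fun p hp ↦ hp.mdifferentiableAt (by simp)
    filter_upwards [(contMDiffAt_extChartAt_symm (I := I) (n := 2) x
      (mem_extChartAt_target x)).continuousAt.eventually h₂,
      (isOpen_extChartAt_target x).mem_nhds (mem_extChartAt_target (I := I) x)] with z hz hzt
    have hs := (contMDiffAt_extChartAt_symm (I := I) (n := 2) x hzt).mdifferentiableAt (by simp)
    have hinv := isInvertible_mfderivWithin_extChartAt_symm hzt
    have h₃ := mvfderiv_comp_apply' (I := 𝓘(ℝ, E)) (I' := I) hz hs rfl (pull V z)
    refine Eq.trans ?_ (h₃.symm.trans ?_)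
    · refine congrArg (fun w ↦ mvfderiv I f (φ.symm z) w) ?_
      have h₄ := hinv.self_apply_inverse (V (φ.symm z))
      rw [I.range_eq_univ, mfderivWithin_univ] at h₄
      have h₅ : pull V z = (mfderiv 𝓘(ℝ, E) I φ.symm z).inverse (V (φ.symm z)) := by
        rw [← mfderivWithin_univ, ← I.range_eq_univ]
        rfl
      rw [h₅]
      exact h₄.symm
    · rw [← mfderiv_eq_fderiv]
      rfl
  rw [mvfderiv_eq_fderiv_comp_extChartAt_symm hfV, mvfderiv_eq_fderiv_comp_extChartAt_symm hfW,
    mvfderiv_eq_fderiv_comp_extChartAt_symm (hf.mdifferentiableAt (by simp)), hbr, ← hφ,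
    (hev V).fderiv_eq, (hev W).fderiv_eq]
  have hc : ContDiffAt ℝ 2 (f ∘ φ.symm) (φ x) := by
    refine ContMDiffAt.contDiffAt ?_
    refine ContMDiffAt.comp (φ x) (g := f) ?_
      (contMDiffAt_extChartAt_symm x (mem_extChartAt_target x))
    rwa [extChartAt_to_inv x]
  rw [fderiv_apply_lieBracket hc (by simp) (hdiff W hW) (hdiff V hV), hpull, hpull]

end ManifoldCalculus

section Adjoint

open Set Filter VectorField
open scoped Topology

variable {E : Type*} [NormedAddCommGroup E] [NormedSpace ℝ E]
  {H : Type*} [TopologicalSpace H] {I : ModelWithCorners ℝ E H}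
  {G : Type*} [TopologicalSpace G] [ChartedSpace H G] [Group G] [LieGroup I ∞ G]
  {F : Type*} [NormedAddCommGroup F] [NormedSpace ℝ F]

variable (I) in
/-- For `a * x * b = 1`, the derivative at `x` of `h ↦ a * h * b`, a map from the tangent space
at `x` to the Lie algebra (it is read in the preferred chart at the unit, so that the target does
not depend on `a`, `b` and `x`). -/
def biTranslate (a b x : G) : TangentSpace I x →L[ℝ] GroupLieAlgebra I G :=
  mvfderiv I (fun h : G ↦ extChartAt I (1 : G) (a * h * b)) x

variable (I) in
/-- The adjoint representation of a Lie group. -/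
def groupAd (g : G) : GroupLieAlgebra I G →L[ℝ] GroupLieAlgebra I G :=
  biTranslate I g g⁻¹ 1

theorem contMDiff_mul_mul (a b : G) : ContMDiff I I ∞ (fun h : G ↦ a * h * b) :=
  (contMDiff_const.mul contMDiff_id).mul contMDiff_const

theorem mvfderiv_extChartAt_one (v : GroupLieAlgebra I G) :
    mvfderiv I (extChartAt I (1 : G)) 1 v = (v : E) := by
  have := mfderiv_extChartAt_self (I := I) (x := (1 : G))
  exact congrArg (fun T : E →L[ℝ] E ↦ T v) this

theorem mvfderiv_mul_mul {f : G → F} {a b x : G} (hf : MDifferentiableAt I 𝓘(ℝ, F) f 1)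
    (h : a * x * b = 1) (v : TangentSpace I x) :
    mvfderiv I (fun h ↦ f (a * h * b)) x v = mvfderiv I f 1 (biTranslate I a b x v) := by
  have hψ := (contMDiff_mul_mul (I := I) a b).mdifferentiable (by simp) x
  have key (y : G) (hy : y = 1) (w : TangentSpace I y) :
      mvfderiv I f y w = mvfderiv I f 1
        (mvfderiv I (extChartAt I (1 : G)) y w : E) := by
    subst hy
    exact congrArg (fun w : E ↦ mvfderiv I f 1 w) (mvfderiv_extChartAt_one w).symm
  rw [mvfderiv_comp_apply' hf hψ h, key _ h]
  refine congrArg (fun w : E ↦ mvfderiv I f 1 w) ?_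
  exact (mvfderiv_comp_apply' (mdifferentiableAt_extChartAt (mem_chart_source H (1 : G)))
    hψ h v).symm

theorem biTranslate_biTranslate {a b x a' b' : G} (h : a * x * b = 1) (h' : a' * b' = 1)
    (v : TangentSpace I x) :
    (biTranslate I a' b' 1 : GroupLieAlgebra I G →L[ℝ] GroupLieAlgebra I G)
        (biTranslate I a b x v) =
      biTranslate I (a' * a) (b * b') x v := by
  have hf : MDifferentiableAt I 𝓘(ℝ, E)
      (fun h : G ↦ extChartAt I (1 : G) (a' * h * b')) 1 := by
    refine MDifferentiableAt.comp (1 : G) (g := extChartAt I (1 : G)) (I' := I) ?_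
      ((contMDiff_mul_mul (I := I) a' b').mdifferentiable (by simp) 1)
    rw [mul_one, h']
    exact mdifferentiableAt_extChartAt (mem_chart_source H (1 : G))
  refine (mvfderiv_mul_mul hf h v).symm.trans ?_
  simp only [biTranslate, mul_assoc]
  rfl

theorem biTranslate_one (v : GroupLieAlgebra I G) : biTranslate I (1 : G) 1 1 v = v := by
  simp only [biTranslate, one_mul, mul_one]
  exact mvfderiv_extChartAt_one v

theorem groupAd_one (v : GroupLieAlgebra I G) : groupAd I (1 : G) v = v := by
  simp only [groupAd, inv_one]
  exact biTranslate_one v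

theorem groupAd_mul (g h : G) (v : GroupLieAlgebra I G) :
    groupAd I (g * h) v = groupAd I g (groupAd I h v) := by
  simp only [groupAd, mul_inv_rev]
  exact (biTranslate_biTranslate (by group) (by group) v).symm

theorem groupAd_inv_groupAd (g : G) (v : GroupLieAlgebra I G) :
    groupAd I g⁻¹ (groupAd I g v) = v := by
  rw [← groupAd_mul, inv_mul_cancel, groupAd_one]

theorem groupAd_groupAd_inv (g : G) (v : GroupLieAlgebra I G) :
    groupAd I g (groupAd I g⁻¹ v) = v := by
  rw [← groupAd_mul, mul_inv_cancel, groupAd_one]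

omit [LieGroup I ∞ G] in
theorem leftTranslate_one (v : GroupLieAlgebra I G) : leftTranslate (1 : G) v = v := by
  have : (fun h : G ↦ 1 * h) = id := by ext; simp
  have h : mfderiv I I (fun h : G ↦ 1 * h) 1 v = (v : E) := by
    rw [this]
    exact congrArg (fun T : E →L[ℝ] E ↦ T v) (mfderiv_id (I := I) (x := (1 : G)))
  exact h

theorem mvfderiv_leftTranslate {f : G → F} {g : G} (hf : MDifferentiableAt I 𝓘(ℝ, F) f g)
    (v : GroupLieAlgebra I G) :
    mvfderiv I f g (leftTranslate g v) = mvfderiv I (fun h ↦ f (g * h)) 1 v := by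
  have hψ : MDifferentiableAt I I (fun h : G ↦ g * h) 1 :=
    (contMDiff_mul_left (I := I) (n := ∞) (a := g)).mdifferentiable (by simp) 1
  rw [mvfderiv_comp_apply' hf hψ (mul_one g)]
  have key (k : G) (hk : k = g) (w : E) : (mvfderiv I f g w : F) = mvfderiv I f k w := by
    subst hk
    rfl
  exact key _ (mul_one g) _

theorem maurerCartan_eq_biTranslate (g : G) (v : TangentSpace I g) :
    maurerCartan g v = biTranslate I g⁻¹ 1 g v := by
  rw [← leftTranslate_maurerCartan g v]
  generalize maurerCartan g v = w
  rw [maurerCartan_leftTranslate]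
  have hf : MDifferentiableAt I 𝓘(ℝ, E)
      (fun h : G ↦ extChartAt I (1 : G) (g⁻¹ * h * 1)) g := by
    refine MDifferentiableAt.comp g (g := extChartAt I (1 : G)) (I' := I) ?_
      ((contMDiff_mul_mul (I := I) g⁻¹ 1).mdifferentiable (by simp) g)
    rw [mul_one, inv_mul_cancel]
    exact mdifferentiableAt_extChartAt (mem_chart_source H (1 : G))
  have h := mvfderiv_leftTranslate hf w
  simp only [mul_one, inv_mul_cancel_left] at h
  refine (mvfderiv_extChartAt_one w).symm.trans (h.symm.trans ?_)
  simp only [biTranslate, mul_one]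
  rfl

theorem inTangentCoordinates_left {c : G → G} {f : G → E} {ϕ : G → E →L[ℝ] E} {g₀ g : G}
    (h : c g ∈ (chartAt H (c g₀)).source) :
    inTangentCoordinates I 𝓘(ℝ, E) c f ϕ g₀ g =
      ϕ g ∘L (tangentBundleCore I G).coordChange (achart H (c g₀)) (achart H (c g)) (c g) := by
  rw [inTangentCoordinates_eq _ _ _ h (mem_univ _)]
  rw [tangentBundleCore_coordChange_model_space]
  rfl

theorem contMDiffAt_biTranslate {a b c : G → G} (g : G) (ha : ContMDiff I I ∞ a)
    (hb : ContMDiff I I ∞ b) (hc : ContMDiff I I ∞ c) (h : ∀ g, a g * c g * b g = 1) :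
    ContMDiffAt I 𝓘(ℝ, E →L[ℝ] E) ∞
      (inTangentCoordinates I 𝓘(ℝ, E) c (fun g ↦ extChartAt I (1 : G) (a g * c g * b g))
        (fun g ↦ (biTranslate I (a g) (b g) (c g) : E →L[ℝ] E)) g) g := by
  refine ContMDiffAt.mfderiv (n := ∞) (fun g h ↦ extChartAt I (1 : G) (a g * h * b g)) c ?_
    hc.contMDiffAt (by simp)
  have h₁ : ContMDiff (I.prod I) I ∞ (fun p : G × G ↦ a p.1 * p.2 * b p.1) :=
    ((ha.comp contMDiff_fst).mul contMDiff_snd).mul (hb.comp contMDiff_fst)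
  refine ContMDiffAt.comp (g, c g) (g := extChartAt I (1 : G)) (I' := I)
    (f := fun p : G × G ↦ a p.1 * p.2 * b p.1) ?_ (h₁ _)
  rw [h]
  exact contMDiffAt_extChartAt

theorem contMDiffAt_mvfderiv_one {Φ : G → G → E} {g : G}
    (hΦ : ContMDiffAt (I.prod I) 𝓘(ℝ, E) ∞ (fun p : G × G ↦ Φ p.1 p.2) (g, 1)) :
    ContMDiffAt I 𝓘(ℝ, E →L[ℝ] E) ∞ (M' := E →L[ℝ] E)
      (fun g : G ↦ (mvfderiv I (Φ g) 1 : GroupLieAlgebra I G →L[ℝ] E)) g := by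
  have := ContMDiffAt.mfderiv (n := ∞) (m := ∞) Φ (fun _ ↦ 1) hΦ contMDiffAt_const (by simp)
  refine this.congr_of_eventuallyEq (.of_forall fun k ↦ ?_)
  refine Eq.trans ?_ (inTangentCoordinates_left (mem_chart_source H (1 : G))).symm
  ext v
  exact congrArg (fun w : E ↦ (mvfderiv I (Φ k) 1 w : E))
    ((tangentBundleCore I G).coordChange_self (achart H (1 : G)) 1
      (mem_achart_source H (1 : G)) v).symm

theorem contMDiff_groupAd :
    ContMDiff I 𝓘(ℝ, E →L[ℝ] E) ∞ (M' := E →L[ℝ] E) (fun g : G ↦ groupAd I g) := by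
  intro g
  refine contMDiffAt_mvfderiv_one (Φ := fun g h ↦ extChartAt I (1 : G) (g * h * g⁻¹)) ?_
  have h₁ : ContMDiff (I.prod I) I ∞ (fun p : G × G ↦ p.1 * p.2 * p.1⁻¹) :=
    (contMDiff_fst.mul contMDiff_snd).mul contMDiff_fst.inv
  refine ContMDiffAt.comp (g, (1 : G)) (g := extChartAt I (1 : G)) (I' := I)
    (f := fun p : G × G ↦ p.1 * p.2 * p.1⁻¹) ?_ (h₁ _)
  rw [mul_one, mul_inv_cancel]
  exact contMDiffAt_extChartAt

theorem mdifferentiable_groupAd :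
    MDifferentiable I 𝓘(ℝ, E →L[ℝ] E) (M' := E →L[ℝ] E) (fun g : G ↦ groupAd I g) :=
  contMDiff_groupAd.mdifferentiable (by simp)

theorem mdifferentiable_groupAd_apply (v : GroupLieAlgebra I G) :
    MDifferentiable I 𝓘(ℝ, E) (M' := E) (fun g : G ↦ groupAd I g v) := fun g ↦
  MDifferentiableAt.clm_apply (F₁ := E) (F₂ := E) (mdifferentiable_groupAd g)
    (f := fun _ ↦ (v : E)) mdifferentiableAt_const

omit [LieGroup I ∞ G] in
theorem mulInvariantVectorField_eq_leftTranslate (v : GroupLieAlgebra I G) (g : G) :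
    mulInvariantVectorField v g = leftTranslate g v := rfl

theorem mdifferentiable_groupAd_inv_apply (v : GroupLieAlgebra I G) :
    MDifferentiable I 𝓘(ℝ, E) (M' := E) (fun g : G ↦ groupAd I g⁻¹ v) :=
  (mdifferentiable_groupAd_apply v).comp ((contMDiff_inv I ∞).mdifferentiable (by simp))

theorem mvfderiv_groupAd (y : GroupLieAlgebra I G) (g : G) (v : TangentSpace I g) :
    mvfderiv I (F := E →L[ℝ] E) (fun g : G ↦ groupAd I g) g v y =
      mvfderiv I (F := E) (fun g : G ↦ groupAd I g y) g v :=
  (mvfderiv_clm_apply_comp (ContinuousLinearMap.apply ℝ E (y : E)) (F := E →L[ℝ] E) (F' := E)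
    (mdifferentiable_groupAd g) v).symm

variable [I.Boundaryless] [CompleteSpace E]

theorem mvfderiv_groupAd_one (x y : GroupLieAlgebra I G) :
    mvfderiv I (F := E) (fun g : G ↦ groupAd I g y) 1 x = (⁅x, y⁆ : GroupLieAlgebra I G) := by
  let φ : G → E := fun g ↦ extChartAt I (1 : G) g
  let P (g : G) : E →L[ℝ] E := mvfderiv I (fun h ↦ φ (g * h)) 1
  let Q (g : G) : E →L[ℝ] E := mvfderiv I (fun h ↦ φ (h * g)) 1
  have h2 : (2 : WithTop ℕ∞) ≤ ∞ := ENat.LEInfty.out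
  have hφ : ContMDiffAt I 𝓘(ℝ, E) ∞ φ 1 := contMDiffAt_extChartAt
  have hφm : ContMDiffAt (I.prod I) 𝓘(ℝ, E) ∞ (fun p : G × G ↦ φ (p.1 * p.2)) (1, 1) := by
    refine ContMDiffAt.comp ((1 : G), (1 : G)) (g := φ) (I' := I)
      (f := fun p : G × G ↦ p.1 * p.2) ?_ ((contMDiff_fst.mul contMDiff_snd) _)
    rwa [mul_one]
  have hφm' : ContMDiffAt (I.prod I) 𝓘(ℝ, E) ∞ (fun p : G × G ↦ φ (p.2 * p.1)) (1, 1) := by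
    refine ContMDiffAt.comp ((1 : G), (1 : G)) (g := φ) (I' := I)
      (f := fun p : G × G ↦ p.2 * p.1) ?_ ((contMDiff_snd.mul contMDiff_fst) _)
    rwa [mul_one]
  have hP : MDifferentiableAt I 𝓘(ℝ, E →L[ℝ] E) P 1 :=
    (contMDiffAt_mvfderiv_one (Φ := fun g h ↦ φ (g * h)) hφm).mdifferentiableAt (by simp)
  have hQ : MDifferentiableAt I 𝓘(ℝ, E →L[ℝ] E) Q 1 :=
    (contMDiffAt_mvfderiv_one (Φ := fun g h ↦ φ (h * g)) hφm').mdifferentiableAt (by simp)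
  have hPa (v : E) : MDifferentiableAt I 𝓘(ℝ, E) (fun g ↦ P g v) 1 :=
    hP.clm_apply mdifferentiableAt_const
  have hQa (v : E) : MDifferentiableAt I 𝓘(ℝ, E) (fun g ↦ Q g v) 1 :=
    hQ.clm_apply mdifferentiableAt_const
  have hφd : ∀ᶠ g in 𝓝 (1 : G), MDifferentiableAt I 𝓘(ℝ, E) φ g := by
    filter_upwards [chart_source_mem_nhds H (1 : G)] with g hg
    exact mdifferentiableAt_extChartAt hg
  have hPv (v : GroupLieAlgebra I G) :
      (fun g ↦ mvfderiv I φ g (mulInvariantVectorField v g)) =ᶠ[𝓝 1] fun g ↦ P g v := by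
    filter_upwards [hφd] with g hg
    exact mvfderiv_leftTranslate hg v
  have hPQ : (fun g ↦ P g y) =ᶠ[𝓝 1] fun g ↦ Q g (groupAd I g y) := by
    filter_upwards [hφd] with g hg
    have hd : MDifferentiableAt I 𝓘(ℝ, E) (fun k ↦ φ (k * g)) 1 := by
      refine MDifferentiableAt.comp (1 : G) (g := φ) (I' := I) ?_
        ((contMDiff_mul_right (I := I) (n := ∞) (a := g)).mdifferentiable (by simp) 1)
      rwa [one_mul]
    have := mvfderiv_mul_mul (a := g) (b := g⁻¹) (x := 1) hd (by simp) y
    simp only [inv_mul_cancel_right] at this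
    exact this
  have hswap : mvfderiv I (fun g ↦ Q g y) 1 x = mvfderiv I (fun g ↦ P g x) 1 y :=
    mvfderiv_mvfderiv_swap (Φ := fun p : G × G ↦ φ (p.1 * p.2)) (hφm.of_le h2) y x
      (hQa y) (hPa x)
  have hbr := mvfderiv_mlieBracket (V := mulInvariantVectorField x)
    (W := mulInvariantVectorField y) (hφ.of_le h2)
    (mdifferentiableAt_mulInvariantVectorField x) (mdifferentiableAt_mulInvariantVectorField y)
    ((hPa x).congr_of_eventuallyEq (hPv x)) ((hPa y).congr_of_eventuallyEq (hPv y))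
  rw [mvfderiv_congr_of_eventuallyEq (hPv x), mvfderiv_congr_of_eventuallyEq (hPv y),
    mvfderiv_congr_of_eventuallyEq hPQ, mulInvariantVectorField_eq_leftTranslate,
    mulInvariantVectorField_eq_leftTranslate, leftTranslate_one, leftTranslate_one, ← hswap] at hbr
  have hprod := mvfderiv_bilin (ContinuousLinearMap.id ℝ (E →L[ℝ] E)) hQ
    (mdifferentiable_groupAd_apply y 1) x
  have hQ1 (v : E) : Q 1 v = v := by
    refine Eq.trans ?_ (mvfderiv_extChartAt_one (I := I) (G := G) v)
    change mvfderiv I (fun h ↦ φ (h * 1)) 1 v = _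
    simp only [mul_one]
    rfl
  have hQd := mvfderiv_clm_apply_comp (F := E →L[ℝ] E) (F' := E)
    (ContinuousLinearMap.apply ℝ E (y : E)) hQ x
  have h₀ : groupAd I (1 : G) y = y := groupAd_one y
  have h₁ : mvfderiv I φ 1 (mlieBracket I (mulInvariantVectorField x)
      (mulInvariantVectorField y) 1) = (⁅x, y⁆ : GroupLieAlgebra I G) :=
    mvfderiv_extChartAt_one (I := I) (G := G) ⁅x, y⁆
  have h₂ : mvfderiv I (fun g ↦ Q g (groupAd I g y)) 1 x =
      mvfderiv I (fun g ↦ Q g y) 1 x + mvfderiv I (F := E) (fun g : G ↦ groupAd I g y) 1 x := by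
    refine hprod.trans (congrArg₂ (fun a b : E ↦ a + b) ?_ (hQ1 _))
    exact (congrArg (mvfderiv I Q 1 x : E →L[ℝ] E) h₀).trans hQd.symm
  have h₃ := hbr.trans (congrArg (fun a : E ↦ a - mvfderiv I (fun g ↦ Q g y) 1 x) h₂)
  rw [add_sub_cancel_left] at h₃
  exact h₃.symm.trans h₁

theorem mvfderiv_groupAd_leftTranslate (g : G) (x y : GroupLieAlgebra I G) :
    mvfderiv I (F := E) (fun g : G ↦ groupAd I g y) g (leftTranslate g x) =
      groupAd I g ⁅x, y⁆ := by
  rw [mvfderiv_leftTranslate (mdifferentiable_groupAd_apply y g)]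
  simp only [groupAd_mul]
  refine (mvfderiv_clm_apply_comp (F := E) (F' := E) (groupAd I g) (f := fun h : G ↦ groupAd I h y)
    (mdifferentiable_groupAd_apply y 1) x).trans ?_
  rw [mvfderiv_groupAd_one]
  rfl

theorem groupAd_lie (g : G) (x y : GroupLieAlgebra I G) :
    groupAd I g ⁅x, y⁆ = ⁅groupAd I g x, groupAd I g y⁆ := by
  have h₁ := mvfderiv_mul_mul (F := E) (f := fun k : G ↦ groupAd I k (groupAd I g y)) (a := g)
    (b := g⁻¹) (x := 1) (mdifferentiable_groupAd_apply _ 1) (by simp) x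
  have h₂ := mvfderiv_clm_apply_comp (F := E) (F' := E) (groupAd I g)
    (f := fun h : G ↦ groupAd I h y)
    (mdifferentiable_groupAd_apply y 1) x
  simp only [groupAd_mul, groupAd_inv_groupAd] at h₁
  refine Eq.trans ?_ (h₂.symm.trans (h₁.trans (mvfderiv_groupAd_one _ _)))
  exact congrArg (groupAd I g) (mvfderiv_groupAd_one x y).symm

theorem mvfderiv_groupAd_inv_one (x y : GroupLieAlgebra I G) :
    mvfderiv I (F := E) (fun g : G ↦ groupAd I g⁻¹ y) 1 x = (-⁅x, y⁆ : GroupLieAlgebra I G) := by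
  have h := mvfderiv_bilin (F := E →L[ℝ] E) (F' := E) (F'' := E)
    (ContinuousLinearMap.id ℝ (E →L[ℝ] E)) (mdifferentiable_groupAd 1)
    (mdifferentiable_groupAd_inv_apply y 1) x
  simp only [ContinuousLinearMap.id_apply] at h
  have h₁ : mvfderiv I (F := E) (fun g : G ↦ groupAd I g (groupAd I g⁻¹ y)) 1 x = 0 := by
    simp only [groupAd_groupAd_inv]
    exact congrArg (fun T : E →L[ℝ] E ↦ T x) (mvfderiv_const (I := I) (M := G) (F := E) y (x := 1))
  have h₂ : groupAd I (1 : G)⁻¹ y = y := by rw [inv_one, groupAd_one]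
  have h₃ : mvfderiv I (F := E →L[ℝ] E) (fun g : G ↦ groupAd I g) 1 x (groupAd I (1 : G)⁻¹ y) =
      (⁅x, y⁆ : GroupLieAlgebra I G) := by
    rw [h₂, mvfderiv_groupAd, mvfderiv_groupAd_one]
  have h₄ := h₁.symm.trans (h.trans (congrArg₂ (fun a b : E ↦ a + b) h₃ (groupAd_one _)))
  exact (neg_eq_of_add_eq_zero_right h₄.symm).symm

theorem mvfderiv_groupAd_inv_leftTranslate (g : G) (x y : GroupLieAlgebra I G) :
    mvfderiv I (F := E) (fun g : G ↦ groupAd I g⁻¹ y) g (leftTranslate g x) =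
      (-⁅x, groupAd I g⁻¹ y⁆ : GroupLieAlgebra I G) := by
  rw [mvfderiv_leftTranslate (mdifferentiable_groupAd_inv_apply y g)]
  simp only [mul_inv_rev, groupAd_mul]
  exact mvfderiv_groupAd_inv_one x _

end Adjoint

section CoadjointForms

open Set Filter VectorField
open scoped Topology

variable {E : Type*} [NormedAddCommGroup E] [NormedSpace ℝ E] [FiniteDimensional ℝ E]
  {H : Type*} [TopologicalSpace H] {I : ModelWithCorners ℝ E H}
  {G : Type*} [TopologicalSpace G] [ChartedSpace H G] [Group G] [LieGroup I ∞ G]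

instance groupLieAlgebraBilinFormAddCommGroup :
    AddCommGroup (LinearMap.BilinForm ℝ (GroupLieAlgebra I G)) :=
  inferInstance

variable (I) in
/-- The action of a Lie group on the bilinear forms on its Lie algebra:
`(g · B)(y, z) = B(Ad g y, Ad g z)`. -/
def groupPullback (g : G) :
    LinearMap.BilinForm ℝ (GroupLieAlgebra I G) →ₗ[ℝ] LinearMap.BilinForm ℝ (GroupLieAlgebra I G) :=
  bilinPullback (groupAd I g).toLinearMap

variable {B : LinearMap.BilinForm ℝ (GroupLieAlgebra I G)}

theorem groupPullback_apply (g : G) (B : LinearMap.BilinForm ℝ (GroupLieAlgebra I G))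
    (y z : GroupLieAlgebra I G) :
    groupPullback I g B y z = B (groupAd I g y) (groupAd I g z) := rfl

theorem groupPullback_one (B : LinearMap.BilinForm ℝ (GroupLieAlgebra I G)) :
    groupPullback I 1 B = B := by
  ext y z
  simp only [groupPullback_apply, groupAd_one]

theorem groupPullback_mul (g h : G) (B : LinearMap.BilinForm ℝ (GroupLieAlgebra I G)) :
    groupPullback I (g * h) B = groupPullback I h (groupPullback I g B) := by
  ext y z
  simp only [groupPullback_apply, groupAd_mul]

theorem groupPullback_inv_self (g : G) (B : LinearMap.BilinForm ℝ (GroupLieAlgebra I G)) :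
    groupPullback I g⁻¹ (groupPullback I g B) = B := by
  rw [← groupPullback_mul, mul_inv_cancel, groupPullback_one]

theorem groupPullback_self_inv (g : G) (B : LinearMap.BilinForm ℝ (GroupLieAlgebra I G)) :
    groupPullback I g (groupPullback I g⁻¹ B) = B := by
  rw [← groupPullback_mul, inv_mul_cancel, groupPullback_one]

/-- A bilinear form on the Lie algebra, as a continuous bilinear form on the model space. -/
def bilinModel (B : LinearMap.BilinForm ℝ (GroupLieAlgebra I G)) : E →L[ℝ] E →L[ℝ] ℝ :=
  LinearMap.toContinuousLinearMap
    ((LinearMap.toContinuousLinearMap : (E →ₗ[ℝ] ℝ) ≃ₗ[ℝ] E →L[ℝ] ℝ).toLinearMap ∘ₗ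
      (B : E →ₗ[ℝ] E →ₗ[ℝ] ℝ))

variable [I.Boundaryless]

theorem groupPullback_mem_cartanSchoutenForms
    (hB : B ∈ cartanSchoutenForms (GroupLieAlgebra I G)) (g : G) :
    groupPullback I g B ∈ cartanSchoutenForms (GroupLieAlgebra I G) := by
  refine ⟨fun y z ↦ hB.1 _ _, fun a b y z ↦ ?_⟩
  simp only [groupPullback_apply, groupAd_lie]
  exact hB.2 _ _ _ _

/-- The family `β` of bilinear forms is differentiable, and its derivative along the left
invariant vector field of `x` is `D · x`. -/
def HasLeftDeriv (β : G → LinearMap.BilinForm ℝ (GroupLieAlgebra I G))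
    (D : G → GroupLieAlgebra I G → LinearMap.BilinForm ℝ (GroupLieAlgebra I G)) : Prop :=
  ∀ y z, MDifferentiable I 𝓘(ℝ, ℝ) (fun g ↦ β g y z) ∧
    ∀ g x, mvfderiv I (fun g ↦ β g y z) g (leftTranslate g x) = D g x y z

section HasLeftDeriv

variable {β γ : G → LinearMap.BilinForm ℝ (GroupLieAlgebra I G)}
  {D D' : G → GroupLieAlgebra I G → LinearMap.BilinForm ℝ (GroupLieAlgebra I G)}

theorem hasLeftDeriv_const (B : LinearMap.BilinForm ℝ (GroupLieAlgebra I G)) :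
    HasLeftDeriv (fun _ : G ↦ B) fun _ _ ↦ 0 := by
  refine fun y z ↦ ⟨mdifferentiable_const, fun g x ↦ ?_⟩
  rw [mvfderiv_const]
  rfl

theorem HasLeftDeriv.add (hβ : HasLeftDeriv β D) (hγ : HasLeftDeriv γ D') :
    HasLeftDeriv (fun g ↦ β g + γ g) fun g x ↦ D g x + D' g x := by
  refine fun y z ↦ ⟨(hβ y z).1.add (hγ y z).1, fun g x ↦ ?_⟩
  have := mvfderiv_fun_add ((hβ y z).1 g) ((hγ y z).1 g)
  simp only [LinearMap.add_apply, this, add_apply, (hβ y z).2, (hγ y z).2]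

theorem HasLeftDeriv.const_smul (hβ : HasLeftDeriv β D) (c : ℝ) :
    HasLeftDeriv (fun g ↦ c • β g) fun g x ↦ c • D g x := by
  refine fun y z ↦ ⟨(hβ y z).1.const_smul c, fun g x ↦ ?_⟩
  have := mvfderiv_clm_apply_comp (c • ContinuousLinearMap.id ℝ ℝ) ((hβ y z).1 g)
    (leftTranslate g x)
  rw [(hβ y z).2] at this
  exact this

theorem HasLeftDeriv.bilinLie (hβ : HasLeftDeriv β D) (a : GroupLieAlgebra I G) :
    HasLeftDeriv (fun g ↦ bilinLie a (β g)) fun g x ↦ bilinLie a (D g x) := by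
  refine fun y z ↦ ⟨?_, fun g x ↦ ?_⟩
  · simp only [bilinLie_apply]
    exact (hβ _ _).1.add (hβ _ _).1
  · simp only [bilinLie_apply]
    have := mvfderiv_fun_add ((hβ ⁅a, y⁆ z).1 g) ((hβ y ⁅a, z⁆).1 g)
    rw [this, add_apply, (hβ _ _).2, (hβ _ _).2]

theorem HasLeftDeriv.groupPullback (hβ : HasLeftDeriv β D) (h : G) :
    HasLeftDeriv (fun g ↦ groupPullback I h (β g)) fun g x ↦ groupPullback I h (D g x) :=
  fun _ _ ↦ hβ _ _

theorem HasLeftDeriv.congr (hβ : HasLeftDeriv β D) (h : ∀ g x, D g x = D' g x) :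
    HasLeftDeriv β D' :=
  fun y z ↦ ⟨(hβ y z).1, fun g x ↦ by rw [(hβ y z).2, h]⟩

theorem HasLeftDeriv.sub (hβ : HasLeftDeriv β D) (hγ : HasLeftDeriv γ D') :
    HasLeftDeriv (fun g ↦ β g - γ g) fun g x ↦ D g x - D' g x := by
  have := hβ.add (hγ.const_smul (-1))
  simpa only [neg_smul, one_smul, ← sub_eq_add_neg] using this

theorem HasLeftDeriv.eq_one [ConnectedSpace G] (hβ : HasLeftDeriv β fun _ _ ↦ 0) (g : G) :
    β g = β 1 := by
  ext y z
  refine eq_of_mvfderiv_eq_zero (hβ y z).1 (fun g v ↦ ?_) g 1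
  rw [← leftTranslate_maurerCartan g v, (hβ y z).2]
  rfl

end HasLeftDeriv

theorem hasLeftDeriv_groupPullback (B : LinearMap.BilinForm ℝ (GroupLieAlgebra I G)) :
    HasLeftDeriv (fun g : G ↦ groupPullback I g B) fun g x ↦ bilinLie x (groupPullback I g B) := by
  refine fun y z ↦ ⟨fun g ↦ mdifferentiableAt_bilin (bilinModel B)
    (mdifferentiable_groupAd_apply y g) (mdifferentiable_groupAd_apply z g), fun g x ↦ ?_⟩
  refine (mvfderiv_bilin (bilinModel B) (mdifferentiable_groupAd_apply y g)
    (mdifferentiable_groupAd_apply z g) (leftTranslate g x)).trans ?_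
  rw [mvfderiv_groupAd_leftTranslate, mvfderiv_groupAd_leftTranslate, bilinLie_apply]
  rfl

theorem hasLeftDeriv_groupPullback_inv (B : LinearMap.BilinForm ℝ (GroupLieAlgebra I G)) :
    HasLeftDeriv (fun g : G ↦ groupPullback I g⁻¹ B)
      fun g x ↦ -groupPullback I g⁻¹ (bilinLie x B) := by
  refine fun y z ↦ ⟨fun g ↦ mdifferentiableAt_bilin (bilinModel B)
    (mdifferentiable_groupAd_inv_apply y g) (mdifferentiable_groupAd_inv_apply z g),
    fun g x ↦ ?_⟩
  refine (mvfderiv_bilin (bilinModel B) (mdifferentiable_groupAd_inv_apply y g)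
    (mdifferentiable_groupAd_inv_apply z g) (leftTranslate g x)).trans ?_
  rw [mvfderiv_groupAd_inv_leftTranslate, mvfderiv_groupAd_inv_leftTranslate,
    LinearMap.neg_apply, LinearMap.neg_apply, groupPullback_apply, bilinLie_apply, neg_add]
  refine congrArg₂ (· + ·) ?_ ?_
  · exact (congrArg (fun T : GroupLieAlgebra I G →ₗ[ℝ] ℝ ↦ T (groupAd I g⁻¹ z))
      (map_neg B ⁅x, groupAd I g⁻¹ y⁆))
  · exact map_neg (B (groupAd I g⁻¹ y)) ⁅x, groupAd I g⁻¹ z⁆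

section Connected

variable [ConnectedSpace G]

theorem groupPullback_eq_self (h : ∀ x, bilinLie x B = 0) (g : G) : groupPullback I g B = B := by
  have := ((hasLeftDeriv_groupPullback_inv (G := G) B).congr (D' := fun _ _ ↦ 0)
    fun g x ↦ by rw [h, map_zero, neg_zero]).eq_one g⁻¹
  rwa [inv_inv, inv_one, groupPullback_one] at this

theorem bilinLie_groupPullback_of_bilinLie_bilinLie
    (h : ∀ x y, bilinLie x (bilinLie y B) = 0) (g : G) (x : GroupLieAlgebra I G) :
    bilinLie x (groupPullback I g B) = bilinLie x B := by
  have := (((hasLeftDeriv_groupPullback_inv (G := G) B).bilinLie x).congr (D' := fun _ _ ↦ 0)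
    fun g y ↦ by rw [groupPullback_eq_self (fun z ↦ h z y), map_neg, h, neg_zero]).eq_one g⁻¹
  rwa [inv_inv, inv_one, groupPullback_one] at this

theorem bilinLie_groupPullback (hB : B ∈ cartanSchoutenForms (GroupLieAlgebra I G)) (g : G)
    (x : GroupLieAlgebra I G) :
    bilinLie x (groupPullback I g B) = groupPullback I g (bilinLie x B) := by
  have h₃ := bilinLie_bilinLie_bilinLie hB
  have := ((((hasLeftDeriv_groupPullback_inv (G := G) B).bilinLie x).sub
    (hasLeftDeriv_groupPullback_inv (G := G) (bilinLie x B))).congr (D' := fun _ _ ↦ 0)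
    fun g y ↦ by
      rw [map_neg, bilinLie_groupPullback_of_bilinLie_bilinLie (fun a b ↦ h₃ a b y),
        groupPullback_eq_self (fun z ↦ h₃ z y x), bilinLie_comm hB x y, sub_self]).eq_one g⁻¹
  rwa [inv_inv, inv_one, groupPullback_one, groupPullback_one, sub_self, sub_eq_zero] at this

/-- `(A(g) - 1)² = 0` on the forms killed by all products of two derivations. -/
theorem groupPullback_groupPullback_of_bilinLie_bilinLie
    (h : ∀ x y, bilinLie x (bilinLie y B) = 0) (g : G) :
    groupPullback I g (groupPullback I g B) = (2 : ℝ) • groupPullback I g B - B := by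
  have := groupPullback_eq_self (B := groupPullback I g B - B) (fun x ↦ by
    rw [map_sub, bilinLie_groupPullback_of_bilinLie_bilinLie h, sub_self]) g
  rw [map_sub] at this
  rw [sub_eq_iff_eq_add.1 this, two_smul]
  abel

/-- `(A(g) - 1)³ = 0` on the symmetric forms that are invariant under the derived algebra. -/
theorem groupPullback_groupPullback_groupPullback
    (hB : B ∈ cartanSchoutenForms (GroupLieAlgebra I G)) (g : G) :
    groupPullback I g (groupPullback I g (groupPullback I g B)) =
      (3 : ℝ) • groupPullback I g (groupPullback I g B) - (3 : ℝ) • groupPullback I g B + B := by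
  have h₃ := bilinLie_bilinLie_bilinLie hB
  have := groupPullback_groupPullback_of_bilinLie_bilinLie (B := groupPullback I g B - B)
    (fun x y ↦ by
      rw [map_sub, bilinLie_groupPullback hB, map_sub,
        bilinLie_groupPullback_of_bilinLie_bilinLie (fun a b ↦ h₃ a b y), sub_self]) g
  simp only [map_sub] at this
  rw [sub_eq_iff_eq_add] at this
  rw [this]
  module

theorem groupPullback_comm (hB : B ∈ cartanSchoutenForms (GroupLieAlgebra I G)) (g h : G) :
    groupPullback I g (groupPullback I h B) = groupPullback I h (groupPullback I g B) := by
  have h₃ := bilinLie_bilinLie_bilinLie hB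
  have key (C : LinearMap.BilinForm ℝ (GroupLieAlgebra I G))
      (hC : ∀ x y, bilinLie x (bilinLie y C) = 0) (g : G) :
      groupPullback I g (groupPullback I h C) = groupPullback I h (groupPullback I g C) := by
    have h₁ := groupPullback_eq_self (B := groupPullback I h C - C) (fun x ↦ by
      rw [map_sub, bilinLie_groupPullback_of_bilinLie_bilinLie hC, sub_self]) g
    have h₂ := groupPullback_eq_self (B := groupPullback I g C - C) (fun x ↦ by
      rw [map_sub, bilinLie_groupPullback_of_bilinLie_bilinLie hC, sub_self]) h
    rw [map_sub, sub_eq_iff_eq_add] at h₁ h₂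
    rw [h₁, h₂]
    abel
  have := (((hasLeftDeriv_groupPullback_inv (G := G) (groupPullback I h B)).sub
    ((hasLeftDeriv_groupPullback_inv (G := G) B).groupPullback h)).congr (D' := fun _ _ ↦ 0)
    fun g y ↦ by
      rw [map_neg, bilinLie_groupPullback hB, key _ (fun a b ↦ h₃ a b y), sub_self]).eq_one g⁻¹
  rwa [inv_inv, inv_one, groupPullback_one, groupPullback_one, sub_self, sub_eq_zero] at this

/-- A family of forms with derivative `(1/2) x · β` is determined by its value at the unit. -/
theorem HasLeftDeriv.eq_zero {β : G → LinearMap.BilinForm ℝ (GroupLieAlgebra I G)}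
    (hβ : HasLeftDeriv β fun g x ↦ (1 / 2 : ℝ) • _root_.bilinLie x (β g))
    (hmem : ∀ g, β g ∈ cartanSchoutenForms (GroupLieAlgebra I G)) (h₁ : β 1 = 0) (g : G) :
    β g = 0 := by
  have key₂ (x y : GroupLieAlgebra I G) (g : G) :
      _root_.bilinLie x (_root_.bilinLie y (β g)) = 0 := by
    have := (((hβ.bilinLie y).bilinLie x).congr (D' := fun _ _ ↦ 0) fun g z ↦ by
      rw [map_smul, map_smul, bilinLie_bilinLie_bilinLie (hmem g), smul_zero]).eq_one g
    simpa [h₁] using this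
  have key₁ (x : GroupLieAlgebra I G) (g : G) : _root_.bilinLie x (β g) = 0 := by
    have := ((hβ.bilinLie x).congr (D' := fun _ _ ↦ 0) fun g z ↦ by
      rw [map_smul, key₂, smul_zero]).eq_one g
    simpa [h₁] using this
  have := (hβ.congr (D' := fun _ _ ↦ 0) fun g z ↦ by rw [key₁, smul_zero]).eq_one g
  rwa [h₁] at this

variable (I) in
/-- The solution `(A(g))^{1/2} B` of the equation `x · β = (1/2) x β` with initial value `B`, where
`A(g)` is the action of `g` on bilinear forms; the binomial series terminates because `A(g)` is
unipotent. -/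
def transportForm (B : LinearMap.BilinForm ℝ (GroupLieAlgebra I G)) (g : G) :
    LinearMap.BilinForm ℝ (GroupLieAlgebra I G) :=
  (3 / 4 : ℝ) • B + (3 / 8 : ℝ) • groupPullback I g B + (-1 / 8 : ℝ) • groupPullback I g⁻¹ B

theorem hasLeftDeriv_transportForm (hB : B ∈ cartanSchoutenForms (GroupLieAlgebra I G)) :
    HasLeftDeriv (transportForm I B) fun g x ↦ (1 / 2 : ℝ) • bilinLie x (transportForm I B g) := by
  have h := (((hasLeftDeriv_const B).const_smul (3 / 4)).add
    ((hasLeftDeriv_groupPullback B).const_smul (3 / 8))).add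
    ((hasLeftDeriv_groupPullback_inv B).const_smul (-1 / 8))
  refine h.congr fun g x ↦ ?_
  have h₃ := bilinLie_bilinLie_bilinLie hB
  simp only [transportForm, map_add, map_smul, bilinLie_groupPullback hB]
  have := congrArg (groupPullback I g⁻¹)
    (groupPullback_groupPullback_of_bilinLie_bilinLie (fun a b ↦ h₃ a b x) g)
  simp only [map_sub, map_smul, groupPullback_inv_self] at this
  rw [this]
  module

theorem transportForm_one (B : LinearMap.BilinForm ℝ (GroupLieAlgebra I G)) :
    transportForm I B 1 = B := by
  simp only [transportForm, inv_one, groupPullback_one]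
  module

theorem transportForm_mem (hB : B ∈ cartanSchoutenForms (GroupLieAlgebra I G)) (g : G) :
    transportForm I B g ∈ cartanSchoutenForms (GroupLieAlgebra I G) :=
  add_mem (add_mem (Submodule.smul_mem _ _ hB)
    (Submodule.smul_mem _ _ (groupPullback_mem_cartanSchoutenForms hB g)))
    (Submodule.smul_mem _ _ (groupPullback_mem_cartanSchoutenForms hB g⁻¹))

theorem groupPullback_inv_of_forall_eq_sq {g h : G}
    (hgh : ∀ B ∈ cartanSchoutenForms (GroupLieAlgebra I G),
      groupPullback I g B = groupPullback I h (groupPullback I h B))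
    (hB : B ∈ cartanSchoutenForms (GroupLieAlgebra I G)) :
    groupPullback I g⁻¹ B = groupPullback I h⁻¹ (groupPullback I h⁻¹ B) := by
  have hYB := groupPullback_mem_cartanSchoutenForms hB h⁻¹
  have := hgh _ (groupPullback_mem_cartanSchoutenForms hYB h⁻¹)
  rw [groupPullback_self_inv, groupPullback_self_inv] at this
  have h₁ := congrArg (groupPullback I g⁻¹) this
  rwa [groupPullback_inv_self, eq_comm] at h₁

theorem transportForm_eq_of_forall_eq_sq {g h : G}
    (hgh : ∀ B ∈ cartanSchoutenForms (GroupLieAlgebra I G),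
      groupPullback I g B = groupPullback I h (groupPullback I h B))
    (hB : B ∈ cartanSchoutenForms (GroupLieAlgebra I G)) :
    transportForm I B g = groupPullback I h B := by
  have h₁ := congrArg (groupPullback I h⁻¹) (groupPullback_groupPullback_groupPullback hB h)
  simp only [map_sub, map_add, map_smul, groupPullback_inv_self] at h₁
  have h₂ := congrArg (groupPullback I h⁻¹) h₁
  simp only [map_sub, map_add, map_smul, groupPullback_inv_self] at h₂
  rw [transportForm, hgh B hB, groupPullback_inv_of_forall_eq_sq hgh hB, h₁]
  have h₃ : groupPullback I h⁻¹ (groupPullback I h⁻¹ B) =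
      groupPullback I h B - (3 : ℝ) • B + (3 : ℝ) • groupPullback I h⁻¹ B := by
    rw [h₂]
    module
  rw [h₃]
  module

end Connected

end CoadjointForms

section SquareRoot

open Set Filter
open scoped Topology

/-- The squares fill a neighbourhood of the unit of a Lie group. -/
theorem eventually_exists_eq_mul_self {E : Type*} [NormedAddCommGroup E] [NormedSpace ℝ E]
    [FiniteDimensional ℝ E] {H : Type*} [TopologicalSpace H] (I : ModelWithCorners ℝ E H)
    [I.Boundaryless] (G : Type*) [TopologicalSpace G] [ChartedSpace H G] [Group G]
    [LieGroup I ∞ G] : ∀ᶠ g : G in 𝓝 1, ∃ h, g = h * h := by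
  set φ := extChartAt I (1 : G)
  have hφ₁ : φ.symm (φ 1) = 1 := extChartAt_to_inv (I := I) (1 : G)
  let ψ : E × E → E := fun p ↦ φ (φ.symm p.1 * φ.symm p.2)
  have hmul : ContMDiffAt 𝓘(ℝ, E × E) I ∞ (fun p : E × E ↦ φ.symm p.1 * φ.symm p.2)
      (φ 1, φ 1) := by
    have hs := contMDiffAt_extChartAt_symm (I := I) (n := ∞) (1 : G)
      (mem_extChartAt_target (I := I) (1 : G))
    refine ContMDiffAt.mul ?_ ?_
    · exact ContMDiffAt.comp (φ 1, φ 1) hs contDiff_fst.contMDiff.contMDiffAt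
    · exact ContMDiffAt.comp (φ 1, φ 1) hs contDiff_snd.contMDiff.contMDiffAt
  have hψ : ContDiffAt ℝ ∞ ψ (φ 1, φ 1) := by
    refine ContMDiffAt.contDiffAt (ContMDiffAt.comp (φ 1, φ 1) (g := φ) (I' := I) ?_ hmul)
    simp only [hφ₁, mul_one]
    exact contMDiffAt_extChartAt
  have hψd : HasFDerivAt ψ (fderiv ℝ ψ (φ 1, φ 1)) (φ 1, φ 1) :=
    (hψ.differentiableAt (by simp)).hasFDerivAt
  have htarget : ∀ᶠ u in 𝓝 (φ 1), φ (φ.symm u) = u :=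
    Filter.mem_of_superset (extChartAt_target_mem_nhds (I := I) (1 : G)) fun _ hu ↦ φ.right_inv hu
  have hl (v : E) : fderiv ℝ ψ (φ 1, φ 1) (v, 0) = v := by
    have h₁ := HasFDerivAt.comp (φ 1) (f := fun u : E ↦ (u, φ 1)) hψd
      ((hasFDerivAt_id (𝕜 := ℝ) (φ 1)).prodMk (hasFDerivAt_const (φ 1) (φ 1)))
    have h₂ := (hasFDerivAt_id (𝕜 := ℝ) (φ 1)).congr_of_eventuallyEq (f₁ := fun u ↦ ψ (u, φ 1))
      (htarget.mono fun u hu ↦ by simpa [ψ, hφ₁] using hu)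
    simpa using congrArg (fun T : E →L[ℝ] E ↦ T v) (h₁.unique h₂)
  have hr (v : E) : fderiv ℝ ψ (φ 1, φ 1) (0, v) = v := by
    have h₁ := HasFDerivAt.comp (φ 1) (f := fun u : E ↦ (φ 1, u)) hψd
      ((hasFDerivAt_const (φ 1) (φ 1)).prodMk (hasFDerivAt_id (𝕜 := ℝ) (φ 1)))
    have h₂ := (hasFDerivAt_id (𝕜 := ℝ) (φ 1)).congr_of_eventuallyEq (f₁ := fun u ↦ ψ (φ 1, u))
      (htarget.mono fun u hu ↦ by simpa [ψ, hφ₁] using hu)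
    simpa using congrArg (fun T : E →L[ℝ] E ↦ T v) (h₁.unique h₂)
  have hstrict := HasStrictFDerivAt.comp (φ 1) (f := fun u : E ↦ (u, u))
    (hψ.hasStrictFDerivAt (by simp))
    ((hasStrictFDerivAt_id (𝕜 := ℝ) (φ 1)).prodMk (hasStrictFDerivAt_id (𝕜 := ℝ) (φ 1)))
  have hmap := hstrict.map_nhds_eq_of_surj (LinearMap.range_eq_top.2 fun w ↦ by
    refine ⟨(1 / 2 : ℝ) • w, ?_⟩
    have h₁ : fderiv ℝ ψ (φ 1, φ 1) ((1 / 2 : ℝ) • w, (1 / 2 : ℝ) • w) = w := by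
      rw [show (((1 / 2 : ℝ) • w, (1 / 2 : ℝ) • w) : E × E) =
        ((1 / 2 : ℝ) • w, 0) + (0, (1 / 2 : ℝ) • w) by simp, map_add, hl, hr]
      module
    exact h₁)
  have hsource : ∀ᶠ u in 𝓝 (φ 1), φ.symm u * φ.symm u ∈ φ.source := by
    have h₁ : ContinuousAt (fun u ↦ φ.symm u * φ.symm u) (φ 1) :=
      hmul.continuousAt.comp (f := fun u : E ↦ (u, u)) (by fun_prop)
    refine h₁ ?_
    simp only [hφ₁, mul_one]
    exact extChartAt_source_mem_nhds (I := I) (1 : G)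
  have himage : ∀ᶠ w in 𝓝 (φ 1), ∃ u, φ.symm u * φ.symm u ∈ φ.source ∧ ψ (u, u) = w := by
    have h₁ := image_mem_map (m := fun u ↦ ψ (u, u)) hsource
    have h₂ : ψ (φ 1, φ 1) = φ 1 := by simp [ψ, hφ₁]
    have h₃ : map (fun u ↦ ψ (u, u)) (𝓝 (φ 1)) = 𝓝 (ψ (φ 1, φ 1)) := hmap
    rw [h₃, h₂] at h₁
    exact h₁
  filter_upwards [(continuousAt_extChartAt (I := I) (1 : G)).eventually himage,
    extChartAt_source_mem_nhds (I := I) (1 : G)] with g ⟨u, hu, hug⟩ hg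
  exact ⟨φ.symm u, (φ.injOn hu hg hug).symm⟩

variable {E : Type*} [NormedAddCommGroup E] [NormedSpace ℝ E] [FiniteDimensional ℝ E]
  {H : Type*} [TopologicalSpace H] {I : ModelWithCorners ℝ E H} [I.Boundaryless]
  {G : Type*} [TopologicalSpace G] [ChartedSpace H G] [Group G] [LieGroup I ∞ G] [ConnectedSpace G]

variable (I) in
/-- The elements of a Lie group that act as a square on the forms invariant under the derived
algebra. -/
def actsAsSquareSubgroup : Subgroup G where
  carrier := {g | ∃ h : G, ∀ B ∈ cartanSchoutenForms (GroupLieAlgebra I G),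
    groupPullback I g B = groupPullback I h (groupPullback I h B)}
  one_mem' := ⟨1, fun B _ ↦ by simp only [groupPullback_one]⟩
  mul_mem' := by
    rintro g g' ⟨h, hh⟩ ⟨h', hh'⟩
    refine ⟨h * h', fun B hB ↦ ?_⟩
    have hB' := groupPullback_mem_cartanSchoutenForms hB h
    simp only [groupPullback_mul]
    rw [hh B hB, hh' _ (groupPullback_mem_cartanSchoutenForms hB' h),
      groupPullback_comm hB' h h']
  inv_mem' := by
    rintro g ⟨h, hh⟩
    refine ⟨h⁻¹, fun B hB ↦ groupPullback_inv_of_forall_eq_sq hh hB⟩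

theorem exists_forall_groupPullback_eq_sq (g : G) :
    ∃ h : G, ∀ B ∈ cartanSchoutenForms (GroupLieAlgebra I G),
      groupPullback I g B = groupPullback I h (groupPullback I h B) := by
  have : IsTopologicalGroup G := topologicalGroup_of_lieGroup I ∞
  have hopen : IsOpen (actsAsSquareSubgroup I (G := G) : Set G) := by
    refine Subgroup.isOpen_of_mem_nhds _ (g := 1) ?_
    filter_upwards [eventually_exists_eq_mul_self I G] with g ⟨h, hg⟩
    exact ⟨h, fun B _ ↦ by rw [hg, groupPullback_mul]⟩
  have huniv := IsClopen.eq_univ ⟨Subgroup.isClosed_of_isOpen _ hopen, hopen⟩ ⟨1, one_mem _⟩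
  exact huniv.ge (mem_univ g)

theorem exists_transportForm_eq (g : G) :
    ∃ h : G, ∀ B ∈ cartanSchoutenForms (GroupLieAlgebra I G),
      transportForm I B g = groupPullback I h B :=
  (exists_forall_groupPullback_eq_sq g).imp fun _ hh _ hB ↦
    transportForm_eq_of_forall_eq_sq hh hB

variable {B : LinearMap.BilinForm ℝ (GroupLieAlgebra I G)}

theorem isLinearMetric_transportForm (hB : IsLinearMetric B)
    (h : SatisfiesCartanSchoutenEquation B) (g : G) : IsLinearMetric (transportForm I B g) := by
  obtain ⟨k, hk⟩ := exists_transportForm_eq (I := I) g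
  rw [hk B ⟨hB.symm, h⟩]
  refine ⟨fun x y ↦ hB.symm _ _, fun x hx ↦ ?_⟩
  have h₁ : groupAd I k x = 0 := hB.nondegenerate _ fun y ↦ by
    have h₂ := hx (groupAd I k⁻¹ y)
    rwa [groupPullback_apply, groupAd_groupAd_inv] at h₂
  rw [← groupAd_inv_groupAd k x, h₁, map_zero]

/-- Forms that correspond to each other under a linear isomorphism have the same signature. -/
theorem hasLinearSignature_congr {V W : Type*} [AddCommGroup V] [Module ℝ V] [AddCommGroup W]
    [Module ℝ W] {B : LinearMap.BilinForm ℝ V} {C : LinearMap.BilinForm ℝ W} (e : V ≃ₗ[ℝ] W)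
    (h : ∀ x y, C (e x) (e y) = B x y) (p q : ℕ) :
    HasLinearSignature B p q ↔ HasLinearSignature C p q := by
  have he : QuadraticMap.Equivalent B.toQuadraticMap C.toQuadraticMap :=
    ⟨⟨e, fun x ↦ h x x⟩⟩
  rw [HasLinearSignature, HasLinearSignature, he.sigPos_eq, he.sigNeg_eq]

variable (I) in
/-- The adjoint action of a group element, as a linear isomorphism. -/
def groupAdEquiv (g : G) : GroupLieAlgebra I G ≃ₗ[ℝ] GroupLieAlgebra I G :=
  .ofLinearMap (groupAd I g).toLinearMap (groupAd I g⁻¹).toLinearMap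
    (LinearMap.ext fun v ↦ groupAd_groupAd_inv g v)
    (LinearMap.ext fun v ↦ groupAd_inv_groupAd g v)

theorem hasLinearSignature_transportForm (hB : B ∈ cartanSchoutenForms (GroupLieAlgebra I G))
    (g : G) (p q : ℕ) :
    HasLinearSignature (transportForm I B g) p q ↔ HasLinearSignature B p q := by
  obtain ⟨k, hk⟩ := exists_transportForm_eq (I := I) g
  exact hasLinearSignature_congr (groupAdEquiv I k) (fun x y ↦ by rw [hk B hB]; rfl) p q

end SquareRoot

section TransportMetric

open Set Filter
open scoped Topology

theorem contDiff_bilinearComp {E F F' : Type*} [NormedAddCommGroup E] [NormedSpace ℝ E]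
    [NormedAddCommGroup F] [NormedSpace ℝ F] [NormedAddCommGroup F'] [NormedSpace ℝ F']
    {n : WithTop ℕ∞} :
    ContDiff ℝ n fun p : (F →L[ℝ] F →L[ℝ] F') × (E →L[ℝ] F) ↦ p.1.bilinearComp p.2 p.2 := by
  have h : ContDiff ℝ n fun p : (F →L[ℝ] F →L[ℝ] F') × (E →L[ℝ] F) ↦
      ((ContinuousLinearMap.compL ℝ E F F').flip p.2).comp (p.1.comp p.2) :=
    ((ContinuousLinearMap.contDiff _).comp contDiff_snd).clm_comp
      (contDiff_fst.clm_comp contDiff_snd)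
  exact h

theorem contMDiff_linear_combination {E F H M : Type*} [NormedAddCommGroup E] [NormedSpace ℝ E]
    [NormedAddCommGroup F] [NormedSpace ℝ F] [TopologicalSpace H] {I : ModelWithCorners ℝ E H}
    [TopologicalSpace M] [ChartedSpace H M] {n : WithTop ℕ∞} {f g h : M → F}
    (hf : ContMDiff I 𝓘(ℝ, F) n f) (hg : ContMDiff I 𝓘(ℝ, F) n g) (hh : ContMDiff I 𝓘(ℝ, F) n h)
    (a b c : ℝ) : ContMDiff I 𝓘(ℝ, F) n fun x ↦ a • f x + b • g x + c • h x :=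
  ((((contDiff_const_smul a).contMDiff.comp hf).add
    ((contDiff_const_smul b).contMDiff.comp hg)).add ((contDiff_const_smul c).contMDiff.comp hh))

variable {E : Type*} [NormedAddCommGroup E] [NormedSpace ℝ E] [FiniteDimensional ℝ E]
  {H : Type*} [TopologicalSpace H] {I : ModelWithCorners ℝ E H}
  {G : Type*} [TopologicalSpace G] [ChartedSpace H G] [Group G] [LieGroup I ∞ G]

theorem contMDiff_bilinModel_groupPullback (B : LinearMap.BilinForm ℝ (GroupLieAlgebra I G)) :
    ContMDiff I 𝓘(ℝ, E →L[ℝ] E →L[ℝ] ℝ) ∞ (fun g : G ↦ bilinModel (groupPullback I g B)) :=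
  (contDiff_bilinearComp (E := E) (F := E) (F' := ℝ)).contMDiff.comp
    (ContMDiff.prodMk_space (contMDiff_const (c := bilinModel B))
      (contMDiff_groupAd (I := I) (G := G)))

theorem bilinModel_transportForm (B : LinearMap.BilinForm ℝ (GroupLieAlgebra I G)) (g : G) :
    bilinModel (transportForm I B g) = (3 / 4 : ℝ) • bilinModel B +
      (3 / 8 : ℝ) • bilinModel (groupPullback I g B) +
      (-1 / 8 : ℝ) • bilinModel (groupPullback I g⁻¹ B) := by
  ext y z
  rfl

theorem contMDiff_bilinModel_transportForm (B : LinearMap.BilinForm ℝ (GroupLieAlgebra I G)) :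
    ContMDiff I 𝓘(ℝ, E →L[ℝ] E →L[ℝ] ℝ) ∞ (fun g : G ↦ bilinModel (transportForm I B g)) := by
  have h₀ : ContMDiff I 𝓘(ℝ, E →L[ℝ] E →L[ℝ] ℝ) ∞ (fun _ : G ↦ bilinModel B) := contMDiff_const
  have h₁ := contMDiff_bilinModel_groupPullback B
  have h₂ : ContMDiff I 𝓘(ℝ, E →L[ℝ] E →L[ℝ] ℝ) ∞
    (fun g : G ↦ bilinModel (groupPullback I g⁻¹ B)) := h₁.comp (contMDiff_inv I ∞)
  simp only [bilinModel_transportForm]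
  exact contMDiff_linear_combination (F := E →L[ℝ] E →L[ℝ] ℝ) h₀ h₁ h₂ (3 / 4) (3 / 8) (-1 / 8)

/-- A field of bilinear forms on the Lie algebra, moved to the tangent spaces by left
translation. -/
def leftTranslateForm (b : G → E →L[ℝ] E →L[ℝ] ℝ) (g : G) :
    TangentSpace I g →L[ℝ] TangentSpace I g →L[ℝ] ℝ :=
  ContinuousLinearMap.bilinearComp (E := E) (F := E) (E' := E) (F' := E) (b g)
    (maurerCartan (I := I) g : E →L[ℝ] E) (maurerCartan (I := I) g : E →L[ℝ] E)

theorem contMDiff_leftTranslateForm {b : G → E →L[ℝ] E →L[ℝ] ℝ}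
    (hb : ContMDiff I 𝓘(ℝ, E →L[ℝ] E →L[ℝ] ℝ) ∞ b) :
    ContMDiff I (I.prod 𝓘(ℝ, E →L[ℝ] E →L[ℝ] ℝ)) ∞
      (fun x ↦ TotalSpace.mk' (E →L[ℝ] E →L[ℝ] ℝ)
        (E := fun x : G ↦ TangentSpace I x →L[ℝ] TangentSpace I x →L[ℝ] ℝ) x
        (leftTranslateForm b x)) := by
  intro g₀
  rw [contMDiffAt_hom_bundle]
  refine ⟨contMDiffAt_id, ?_⟩
  have hθ := contMDiffAt_biTranslate (I := I) (a := fun g : G ↦ g⁻¹) (b := fun _ ↦ 1)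
    (c := id) g₀ (contMDiff_inv I ∞) contMDiff_const contMDiff_id (by simp)
  have h := contDiff_bilinearComp.contMDiff.contMDiffAt.comp g₀ (hb.contMDiffAt.prodMk_space hθ)
  refine h.congr_of_eventuallyEq ?_
  filter_upwards [(chartAt H g₀).open_source.mem_nhds (mem_chart_source H g₀)] with g hg
  have h₁ := inTangentCoordinates_left (I := I) (c := id)
    (f := fun g : G ↦ extChartAt I (1 : G) (g⁻¹ * id g * 1))
    (ϕ := fun g ↦ (biTranslate I g⁻¹ 1 g : E →L[ℝ] E)) hg
  have h₂ (v : E) : inTangentCoordinates I 𝓘(ℝ, E) id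
      (fun g : G ↦ extChartAt I (1 : G) (g⁻¹ * id g * 1))
      (fun g ↦ (biTranslate I g⁻¹ 1 g : E →L[ℝ] E)) g₀ g v =
      maurerCartan g ((trivializationAt E (TangentSpace I) g₀).symm g v) := by
    rw [h₁, maurerCartan_eq_biTranslate]
    have h₃ := TangentBundle.symmL_trivializationAt_eq_core (I := I) hg
    have h₄ : (tangentBundleCore I G).coordChange (achart H g₀) (achart H g) g v =
        (trivializationAt E (TangentSpace I) g₀).symm g v :=
      (congrArg (fun T : E →L[ℝ] E ↦ T v) h₃).symm.trans (Trivialization.symmL_apply _ hg _)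
    exact congrArg (biTranslate I g⁻¹ 1 g : E →L[ℝ] E) h₄
  ext v w
  refine Eq.trans (inCoordinates_apply_eq₂ (E₁ := fun x : G ↦ TangentSpace I x)
    (E₂ := fun x : G ↦ TangentSpace I x) (E₃ := Bundle.Trivial G ℝ) hg hg (mem_univ _)) ?_
  refine Eq.trans (congrArg (fun T : ℝ →ₗ[ℝ] ℝ ↦ T (leftTranslateForm b g
    ((trivializationAt E (TangentSpace I) g₀).symm g v)
    ((trivializationAt E (TangentSpace I) g₀).symm g w)))
    (Bundle.Trivial.linearMapAt_trivialization ℝ G ℝ g)) ?_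
  exact (congrArg₂ (fun v w : E ↦ b g v w) (h₂ v) (h₂ w)).symm

end TransportMetric

section CartanSchoutenMetrics

open Set Filter VectorField
open scoped Topology

variable {E : Type*} [NormedAddCommGroup E] [NormedSpace ℝ E] [FiniteDimensional ℝ E]
  {H : Type*} [TopologicalSpace H] {I : ModelWithCorners ℝ E H}
  {G : Type*} [TopologicalSpace G] [ChartedSpace H G] [Group G] [LieGroup I ∞ G]

theorem cartanSchoutenConnection_apply (Y : ∀ g : G, TangentSpace I g) (g : G)
    (v : TangentSpace I g) :
    cartanSchoutenConnection I G Y g v =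
      leftTranslate g ((lieAlgebraModelEquiv I G).symm
        (mvfderiv I (fun h ↦ lieAlgebraModelEquiv I G (maurerCartan h (Y h))) g v)) +
      (1 / 2 : ℝ) • leftTranslate g ⁅maurerCartan g v, maurerCartan g (Y g)⁆ := rfl

theorem maurerCartan_cartanSchoutenConnection (Y : ∀ g : G, TangentSpace I g) (g : G)
    (v : TangentSpace I g) :
    maurerCartan g (cartanSchoutenConnection I G Y g v) =
      (lieAlgebraModelEquiv I G).symm
        (mvfderiv I (fun h ↦ lieAlgebraModelEquiv I G (maurerCartan h (Y h))) g v) +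
      (1 / 2 : ℝ) • ⁅maurerCartan g v, maurerCartan g (Y g)⁆ := by
  rw [cartanSchoutenConnection_apply, map_add, map_smul, maurerCartan_leftTranslate,
    maurerCartan_leftTranslate]

set_option synthInstance.maxHeartbeats 400000 in
/-- The derivative of `g ↦ β(g)(Y g, Z g)`. -/
theorem mvfderiv_clm_apply₂ {F M : Type*} [NormedAddCommGroup F] [NormedSpace ℝ F]
    [TopologicalSpace M] [ChartedSpace H M]
    {b : M → F →L[ℝ] F →L[ℝ] ℝ} {Y Z : M → F} {x : M}
    (hb : MDifferentiableAt I 𝓘(ℝ, F →L[ℝ] F →L[ℝ] ℝ) b x)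
    (hY : MDifferentiableAt I 𝓘(ℝ, F) Y x) (hZ : MDifferentiableAt I 𝓘(ℝ, F) Z x)
    (v : TangentSpace I x) :
    mvfderiv I (fun z ↦ b z (Y z) (Z z)) x v =
      mvfderiv I (fun z ↦ b z (Y x) (Z x)) x v + b x (mvfderiv I Y x v) (Z x) +
        b x (Y x) (mvfderiv I Z x v) := by
  have h₁ := mvfderiv_bilin (F := F →L[ℝ] F →L[ℝ] ℝ) (F' := F) (F'' := F →L[ℝ] ℝ)
    (ContinuousLinearMap.id ℝ (F →L[ℝ] F →L[ℝ] ℝ)) hb hY v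
  have h₂ := mvfderiv_bilin (F := F →L[ℝ] ℝ) (F' := F) (F'' := ℝ)
    (ContinuousLinearMap.id ℝ (F →L[ℝ] ℝ)) (mdifferentiableAt_bilin
    (F := F →L[ℝ] F →L[ℝ] ℝ) (F' := F) (F'' := F →L[ℝ] ℝ)
    (ContinuousLinearMap.id ℝ (F →L[ℝ] F →L[ℝ] ℝ)) hb hY) hZ v
  have h₃ := mvfderiv_clm_apply_comp (F := F →L[ℝ] F →L[ℝ] ℝ) (F' := ℝ)
    (ContinuousLinearMap.apply ℝ ℝ (Z x) ∘L
    ContinuousLinearMap.apply ℝ (F →L[ℝ] ℝ) (Y x)) hb v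
  simp only [ContinuousLinearMap.id_apply] at h₁ h₂
  rw [h₁] at h₂
  refine h₂.trans ?_
  rw [add_apply]
  exact congrArg (fun t ↦ t + b x (mvfderiv I Y x v) (Z x) + b x (Y x) (mvfderiv I Z x v)) h₃.symm

variable [I.Boundaryless] [ConnectedSpace G] {B : LinearMap.BilinForm ℝ (GroupLieAlgebra I G)}

/-- The metric on the group obtained from a metric on the Lie algebra by parallel transport. -/
def transportMetric (B : LinearMap.BilinForm ℝ (GroupLieAlgebra I G)) (hB : IsLinearMetric B)
    (h : SatisfiesCartanSchoutenEquation B) : PseudoRiemannianMetric I G where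
  val := leftTranslateForm fun g ↦ bilinModel (transportForm I B g)
  contMDiff := contMDiff_leftTranslateForm (contMDiff_bilinModel_transportForm B)
  isLinearMetric g := by
    have hT := isLinearMetric_transportForm hB h g
    refine ⟨fun v w ↦ hT.symm _ _, fun v hv ↦ ?_⟩
    have h₁ : maurerCartan g v = 0 := hT.nondegenerate _ fun y ↦ by
      have := hv (leftTranslate g y)
      rw [← maurerCartan_leftTranslate g y]
      exact this
    rw [← leftTranslate_maurerCartan g v, h₁, map_zero]

theorem transportMetric_val (hB : IsLinearMetric B) (h : SatisfiesCartanSchoutenEquation B) (g : G)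
    (v w : TangentSpace I g) : (transportMetric B hB h).val g v w =
      transportForm I B g (maurerCartan g v) (maurerCartan g w) := rfl

theorem isCartanSchouten_transportMetric (hB : IsLinearMetric B)
    (h : SatisfiesCartanSchoutenEquation B) :
    (transportMetric (G := G) B hB h).IsCartanSchouten := by
  intro g Y Z hY hZ v
  have hb : MDifferentiableAt I 𝓘(ℝ, E →L[ℝ] E →L[ℝ] ℝ)
      (fun g : G ↦ bilinModel (transportForm I B g)) g :=
    (contMDiff_bilinModel_transportForm B).mdifferentiable (by simp) g
  have key := mvfderiv_clm_apply₂ hb (mdifferentiableAt_maurerCartan hY)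
    (mdifferentiableAt_maurerCartan hZ) v
  refine key.trans ?_
  have hd := (hasLeftDeriv_transportForm (G := G) (B := B) ⟨hB.symm, h⟩
    (maurerCartan g (Y g)) (maurerCartan g (Z g))).2 g (maurerCartan g v)
  rw [leftTranslate_maurerCartan] at hd
  rw [transportMetric_val, transportMetric_val, maurerCartan_cartanSchoutenConnection,
    maurerCartan_cartanSchoutenConnection]
  set y : GroupLieAlgebra I G := maurerCartan g (Y g)
  set z : GroupLieAlgebra I G := maurerCartan g (Z g)
  set y' : GroupLieAlgebra I G := (lieAlgebraModelEquiv I G).symm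
    (mvfderiv I (fun h ↦ lieAlgebraModelEquiv I G (maurerCartan h (Y h))) g v)
  set z' : GroupLieAlgebra I G := (lieAlgebraModelEquiv I G).symm
    (mvfderiv I (fun h ↦ lieAlgebraModelEquiv I G (maurerCartan h (Z h))) g v)
  set T := transportForm I B g
  set x : GroupLieAlgebra I G := maurerCartan g v
  have e : (1 / 2 : ℝ) • bilinLie x T y z + T y' z + T y z' =
      T (y' + (1 / 2 : ℝ) • ⁅x, y⁆) z + T y (z' + (1 / 2 : ℝ) • ⁅x, z⁆) := by
    simp only [map_add, map_smul, LinearMap.add_apply, LinearMap.smul_apply, bilinLie_apply,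
      smul_eq_mul]
    ring
  refine Eq.trans ?_ e
  exact congrArg (fun t ↦ t + T y' z + T y z') hd

theorem atUnit_transportMetric (hB : IsLinearMetric B) (h : SatisfiesCartanSchoutenEquation B) :
    (transportMetric (G := G) B hB h).atUnit = B := by
  have hθ (v : GroupLieAlgebra I G) : maurerCartan (1 : G) v = v := by
    have := maurerCartan_leftTranslate (1 : G) v
    rwa [leftTranslate_one] at this
  ext y z
  refine (transportMetric_val hB h 1 y z).trans ?_
  rw [transportForm_one, hθ, hθ]

/-- The value of a metric at `g`, moved to the Lie algebra by left translation. -/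
def PseudoRiemannianMetric.leftForm (μ : PseudoRiemannianMetric I G) (g : G) :
    LinearMap.BilinForm ℝ (GroupLieAlgebra I G) :=
  LinearMap.mk₂ ℝ (fun y z ↦ μ.val g (leftTranslate g y) (leftTranslate g z))
    (by simp) (by simp) (by simp) (by simp)

namespace PseudoRiemannianMetric

variable {μ : PseudoRiemannianMetric I G}

theorem leftForm_apply (g : G) (y z : GroupLieAlgebra I G) :
    μ.leftForm g y z = μ.val g (leftTranslate g y) (leftTranslate g z) := rfl

theorem leftForm_one : μ.leftForm 1 = μ.atUnit := by
  ext y z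
  rw [leftForm_apply, leftTranslate_one, leftTranslate_one]
  rfl

theorem contMDiff_leftForm (y z : GroupLieAlgebra I G) :
    ContMDiff I 𝓘(ℝ, ℝ) 2 (fun g ↦ μ.leftForm g y z) := by
  have h2 : (2 : WithTop ℕ∞) ≤ ∞ := ENat.LEInfty.out
  have hv (v : GroupLieAlgebra I G) : ContMDiff I (I.prod 𝓘(ℝ, E)) 2
      (fun g : G ↦ (⟨g, mulInvariantVectorField v g⟩ : TangentBundle I G)) :=
    (contMDiff_mulInvariantVectorField v).of_le le_minSmoothness
  have h : ContMDiff I (I.prod 𝓘(ℝ, ℝ)) 2 (fun g ↦ TotalSpace.mk' ℝ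
      (E := Bundle.Trivial G ℝ) g (μ.leftForm g y z)) :=
    ContMDiff.clm_bundle_apply₂ (F₁ := E) (F₂ := E) (E₁ := fun g : G ↦ TangentSpace I g)
      (E₂ := fun g : G ↦ TangentSpace I g) (E₃ := Bundle.Trivial G ℝ) (b := fun g : G ↦ g)
      (μ.contMDiff.of_le h2) (hv y) (hv z)
  intro g
  have hg := h g
  rw [contMDiffAt_totalSpace] at hg
  exact hg.2

theorem IsCartanSchouten.hasLeftDeriv (hμ : μ.IsCartanSchouten) :
    HasLeftDeriv μ.leftForm fun g x ↦ (1 / 2 : ℝ) • bilinLie x (μ.leftForm g) := by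
  refine fun y z ↦ ⟨(contMDiff_leftForm y z).mdifferentiable (by simp), fun g x ↦ ?_⟩
  refine (hμ g _ _ (mdifferentiableAt_mulInvariantVectorField y)
    (mdifferentiableAt_mulInvariantVectorField z) (mulInvariantVectorField x g)).trans ?_
  rw [cartanSchoutenConnection_mulInvariantVectorField,
    cartanSchoutenConnection_mulInvariantVectorField]
  simp only [map_smul, LinearMap.smul_apply, bilinLie_apply, leftForm_apply, smul_apply,
    mulInvariantVectorField_eq_leftTranslate, smul_eq_mul]
  ring

theorem leftForm_mem (hμ : μ.IsCartanSchouten) (g : G) :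
    μ.leftForm g ∈ cartanSchoutenForms (GroupLieAlgebra I G) := by
  refine ⟨fun y z ↦ (μ.isLinearMetric g).symm _ _, fun x w y z ↦ ?_⟩
  have hd := hμ.hasLeftDeriv
  have hd₂ (a b : GroupLieAlgebra I G) (k : G) :
      mvfderiv I (fun k ↦ mvfderiv I (fun k ↦ μ.leftForm k y z) k (mulInvariantVectorField b k)) k
        (mulInvariantVectorField a k) =
      (1 / 4 : ℝ) * bilinLie b (bilinLie a (μ.leftForm k)) y z := by
    have h₁ : (fun k ↦ mvfderiv I (fun k ↦ μ.leftForm k y z) k (mulInvariantVectorField b k)) =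
        fun k ↦ ((1 / 2 : ℝ) • bilinLie b (μ.leftForm k)) y z :=
      funext fun k ↦ (hd y z).2 k b
    rw [h₁]
    refine (((hd.bilinLie b).const_smul (1 / 2)) y z |>.2 k a).trans ?_
    simp only [map_smul, LinearMap.smul_apply, smul_eq_mul]
    ring
  have hdiff (b : GroupLieAlgebra I G) : MDifferentiableAt I 𝓘(ℝ, ℝ)
      (fun k ↦ mvfderiv I (fun k ↦ μ.leftForm k y z) k (mulInvariantVectorField b k)) g := by
    refine ((((hd.bilinLie b).const_smul (1 / 2)) y z).1 g).congr_of_eventuallyEq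
      (.of_forall fun k ↦ (hd y z).2 k b)
  have h := mvfderiv_mlieBracket (contMDiff_leftForm (μ := μ) y z g)
    (mdifferentiableAt_mulInvariantVectorField x) (mdifferentiableAt_mulInvariantVectorField w)
    (hdiff x) (hdiff w)
  rw [hd₂, hd₂, ← mulInvariantVector_mlieBracket, mulInvariantVectorField_eq_leftTranslate] at h
  have h₁ := ((hd y z).2 g ⁅x, w⁆).symm.trans h
  simp only [LinearMap.smul_apply, bilinLie_apply, smul_eq_mul] at h₁
  simp only [lie_lie, map_sub, LinearMap.sub_apply] at h₁ ⊢
  linarith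

theorem leftForm_eq_transportForm (hμ : μ.IsCartanSchouten) (g : G) :
    μ.leftForm g = transportForm I μ.atUnit g := by
  have h₁ : μ.atUnit ∈ cartanSchoutenForms (GroupLieAlgebra I G) := by
    rw [← leftForm_one]
    exact leftForm_mem hμ 1
  have := HasLeftDeriv.eq_zero (β := fun g ↦ μ.leftForm g - transportForm I μ.atUnit g)
    ((hμ.hasLeftDeriv.sub (hasLeftDeriv_transportForm h₁)).congr fun g x ↦ by
      rw [map_sub, smul_sub])
    (fun g ↦ sub_mem (leftForm_mem hμ g) (transportForm_mem h₁ g))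
    (by rw [leftForm_one, transportForm_one, sub_self]) g
  exact sub_eq_zero.1 this

variable (I) in
/-- Left translation by a group element, as a linear isomorphism. -/
def leftTranslateEquiv (g : G) : GroupLieAlgebra I G ≃ₗ[ℝ] TangentSpace I g :=
  .ofLinearMap (leftTranslate g).toLinearMap (maurerCartan g).toLinearMap
    (LinearMap.ext fun v ↦ leftTranslate_maurerCartan g v)
    (LinearMap.ext fun v ↦ maurerCartan_leftTranslate g v)

theorem hasSignature_iff (hμ : μ.IsCartanSchouten) (p q : ℕ) :
    μ.HasSignature p q ↔ HasLinearSignature μ.atUnit p q := by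
  have h₁ : μ.atUnit ∈ cartanSchoutenForms (GroupLieAlgebra I G) := by
    rw [← leftForm_one]
    exact leftForm_mem hμ 1
  have h (g : G) : HasLinearSignature (μ.val g).toBilinForm p q ↔
      HasLinearSignature μ.atUnit p q := by
    rw [← hasLinearSignature_transportForm h₁ g, ← leftForm_eq_transportForm hμ,
      hasLinearSignature_congr (B := μ.leftForm g) (C := (μ.val g).toBilinForm)
        (leftTranslateEquiv I g) (fun _ _ ↦ rfl)]
  exact ⟨fun hs ↦ (h 1).1 (hs 1), fun hs g ↦ (h g).2 hs⟩

end PseudoRiemannianMetric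

end CartanSchoutenMetrics

end

theorem mainTheorem3 {E : Type*} [NormedAddCommGroup E] [NormedSpace ℝ E] [FiniteDimensional ℝ E]
    {H : Type*} [TopologicalSpace H] (I : ModelWithCorners ℝ E H) [I.Boundaryless]
    (G : Type*) [TopologicalSpace G] [ChartedSpace H G] [Group G] [LieGroup I ∞ G]
    [ConnectedSpace G] :
    -- existence of a metric of given signature on the group and on the Lie algebra
    (∀ p q : ℕ,
      (∃ μ : PseudoRiemannianMetric I G, μ.IsCartanSchouten ∧ μ.HasSignature p q) ↔
      (∃ B : LinearMap.BilinForm ℝ (GroupLieAlgebra I G),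
        IsLinearMetric B ∧ SatisfiesCartanSchoutenEquation B ∧ HasLinearSignature B p q)) ∧
    -- the value at the unit of a Cartan–Schouten metric is such a metric on the Lie algebra
    (∀ μ : PseudoRiemannianMetric I G, μ.IsCartanSchouten →
      IsLinearMetric μ.atUnit ∧ SatisfiesCartanSchoutenEquation μ.atUnit ∧
        ∀ p q : ℕ, μ.HasSignature p q ↔ HasLinearSignature μ.atUnit p q) ∧
    -- every such metric on the Lie algebra is the value at the unit of a Cartan–Schouten metric
    (∀ B : LinearMap.BilinForm ℝ (GroupLieAlgebra I G),
      IsLinearMetric B → SatisfiesCartanSchoutenEquation B →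
      ∃ μ : PseudoRiemannianMetric I G, μ.IsCartanSchouten ∧ μ.atUnit = B ∧
        ∀ p q : ℕ, μ.HasSignature p q ↔ HasLinearSignature B p q) ∧
    -- the equation says that `ad u` is skew-symmetric for every `u` in the derived algebra
    (∀ B : LinearMap.BilinForm ℝ (GroupLieAlgebra I G),
      SatisfiesCartanSchoutenEquation B ↔
        ∀ u ∈ LieAlgebra.derivedSeries ℝ (GroupLieAlgebra I G) 1,
          B.IsSkewAdjoint (LieAlgebra.ad ℝ (GroupLieAlgebra I G) u)) := by
  have hpart₂ (μ : PseudoRiemannianMetric I G) (hμ : μ.IsCartanSchouten) :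
      IsLinearMetric μ.atUnit ∧ SatisfiesCartanSchoutenEquation μ.atUnit ∧
        ∀ p q : ℕ, μ.HasSignature p q ↔ HasLinearSignature μ.atUnit p q := by
    refine ⟨μ.isLinearMetric 1, ?_, PseudoRiemannianMetric.hasSignature_iff hμ⟩
    rw [← PseudoRiemannianMetric.leftForm_one]
    exact (PseudoRiemannianMetric.leftForm_mem hμ 1).2
  have hpart₃ (B : LinearMap.BilinForm ℝ (GroupLieAlgebra I G)) (hB : IsLinearMetric B)
      (h : SatisfiesCartanSchoutenEquation B) :
      ∃ μ : PseudoRiemannianMetric I G, μ.IsCartanSchouten ∧ μ.atUnit = B ∧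
        ∀ p q : ℕ, μ.HasSignature p q ↔ HasLinearSignature B p q := by
    have hμ := isCartanSchouten_transportMetric (G := G) hB h
    refine ⟨transportMetric B hB h, hμ, atUnit_transportMetric hB h, fun p q ↦ ?_⟩
    rw [PseudoRiemannianMetric.hasSignature_iff hμ, atUnit_transportMetric]
  refine ⟨fun p q ↦ ⟨?_, ?_⟩, hpart₂, hpart₃,
    fun B ↦ satisfiesCartanSchoutenEquation_iff_isSkewAdjoint B⟩
  · rintro ⟨μ, hμ, hs⟩
    obtain ⟨h₁, h₂, h₃⟩ := hpart₂ μ hμ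
    exact ⟨μ.atUnit, h₁, h₂, (h₃ p q).1 hs⟩
  · rintro ⟨B, hB, h, hs⟩
    obtain ⟨μ, hμ, -, h₃⟩ := hpart₃ B hB h
    exact ⟨μ, hμ, (h₃ p q).2 hs⟩
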